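/- Let $X$ and $Y$ be geometric simplicial complexes, with $X$ locally finite, and let $f\colon X\to Y$ be a surjective simplicial map with finite fibres. For $k\ge 1$ let $$W^k(f)=\{(x_1,\dots,x_k)\in X^k : f(x_1)=\dots=f(x_k)\}$$ and let $D^k(f)$ be the closure in $X^k$ of the set of those $(x_1,\dots,x_k)\in W^k(f)$ whose components are pairwise distinct. Then $f$ is injective on every simplex, and $W^k(f)$ is triangulated by the simplices with vertices $(v_0^{(1)},\dots,v_0^{(k)}),\dots,(v_n^{(1)},\dots,v_n^{(k)})$, where for each $\ell$ the $v_0^{(\ell)},\dots,v_n^{(\ell)}$ are the distinct vertices of a simplex of $X$ and $f(v_j^{(1)})=\dots=f(v_j^{(k)})$ for each $j$; the simplices of $W^k(f)$ contained in $D^k(f)$ triangulate $D^k(f)$. Let $C_n$ denote the group of simplicial $n$-chains with integer coefficients, in either of the following two conventions (the same one throughout): the free abelian group on the ordered $n$-simplices $[v_0,\dots,v_n]$ (with distinct vertices $v_i$), or its quotient, the group of oriented chains, by the relations $[v_{\sigma(0)},\dots,v_{\sigma(n)}]=\mathrm{sign}(\sigma)[v_0,\dots,v_n]$. Let $\partial$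 be the usual boundary map and let $H_n(Y)$ be the homology of $(C_\bullet(Y),\partial)$ (in the oriented convention, the usual simplicial homology of $Y$). Let $C_n^{\mathrm{Alt}}(D^k(f))$ be the group of chains $c\in C_n(D^k(f))$ with $\sigma_\#(c)=\mathrm{sign}(\sigma)\,c$ for all $\sigma\in S_k$, where $S_k$ permutes the components of $X^k$. Let $\varepsilon^{i,k}$ be the projection that forgets the $i$-th of $k$ components, and on $n$-chains put $$\varrho^k_n=(-1)^n\sum_{i=1}^k(-1)^{i-1}\varepsilon^{i,k}_{\#},\qquad \epsilon^k_n=(-1)^n\varepsilon^{k,k}_{\#}.$$ Let $C$ be either of the two first quadrant double complexes, with $n,k\ge 0$, $$\bigl(C_n(W^{k+1}(f)),\ \partial,\ \varrho\bigr)\qquad\text{and}\qquad \bigl(C_n^{\mathrm{Alt}}(D^{k+1}(f)),\ \partial,\ \epsilon\bigr),$$ in which the term with indices $n,k$ has bidegree $(p,q)=(n,k)$. The first spectral sequence ${}^IE^r_{p,q}$ of $C$ is that of the total complex $\mathrm{Tot}(C)$ filtered by $F^p(\mathrm{Tot}(C)_n)=\bigoplus_{i\le p}C_{i,n-i}$.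 Then this spectral sequence collapses onto the $p$-axis, that is, ${}^IE^2_{p,q}=0$ for all $p$ and all $q\ne0$, and for every $n\ge0$ $${}^IE^2_{n,0}\cong H_n(\mathrm{Tot}(C))\cong H_n(Y).$$ -/

import Mathlib

open scoped Topology

namespace ICSS

universe u v

/-! ### Double complexes, total complexes and the first spectral sequence -/

/-- A first quadrant double complex of `ℤ`-modules: a bigraded module `C p q` (`p, q ≥ 0`) with
differentials `d'` of bidegree `(-1, 0)` and `d''` of bidegree `(0, -1)` which anticommute. -/
structure DoubleComplex where
  C : ℕ → ℕ → Type u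
  [grp : ∀ p q, AddCommGroup (C p q)]
  d' : ∀ p q, C (p + 1) q →ₗ[ℤ] C p q
  d'' : ∀ p q, C p (q + 1) →ₗ[ℤ] C p q
  d'_d' : ∀ p q x, d' p q (d' (p + 1) q x) = 0
  d''_d'' : ∀ p q x, d'' p q (d'' p (q + 1) x) = 0
  anticomm : ∀ p q x, d' p q (d'' (p + 1) q x) + d'' p q (d' p (q + 1) x) = 0

attribute [instance] DoubleComplex.grp

namespace DoubleComplex

open scoped Classical in
/-- The sum of all `C p q`. The total complex lives in it: its term of degree `n` is the
submodule `K.totDeg n` of the elements whose components have bidegrees `(p, q)`, `p + q = n`. -/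
abbrev Tot (K : DoubleComplex.{u}) : Type u :=
  DirectSum (ℕ × ℕ) fun pq => K.C pq.1 pq.2

open scoped Classical in
/-- `d'` out of `C p q`, with values in the total module. -/
noncomputable def totHor (K : DoubleComplex.{u}) : ∀ p q : ℕ, K.C p q →ₗ[ℤ] K.Tot
  | 0, _ => 0
  | p + 1, q =>
    (DirectSum.lof ℤ (ℕ × ℕ) (fun pq => K.C pq.1 pq.2) (p, q)).comp (K.d' p q)

open scoped Classical in
/-- `d''` out of `C p q`, with values in the total module. -/
noncomputable def totVert (K : DoubleComplex.{u}) : ∀ p q : ℕ, K.C p q →ₗ[ℤ] K.Tot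
  | _, 0 => 0
  | p, q + 1 =>
    (DirectSum.lof ℤ (ℕ × ℕ) (fun pq => K.C pq.1 pq.2) (p, q)).comp (K.d'' p q)

open scoped Classical in
/-- The differential `D = ∑ (d' + d'')` of the total complex. -/
noncomputable def totD (K : DoubleComplex.{u}) : K.Tot →ₗ[ℤ] K.Tot :=
  DirectSum.toModule ℤ (ℕ × ℕ) K.Tot fun pq => K.totHor pq.1 pq.2 + K.totVert pq.1 pq.2

/-- `Tot(C)_n = ⨁_{p + q = n} C p q` (zero for `n < 0`). -/
def totDeg (K : DoubleComplex.{u}) (n : ℤ) : Submodule ℤ K.Tot where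
  carrier := {x | ∀ pq : ℕ × ℕ, (pq.1 : ℤ) + pq.2 ≠ n → x pq = 0}
  zero_mem' := fun _ _ => rfl
  add_mem' := fun {a b} ha hb pq h => by
    rw [DirectSum.add_apply, ha pq h, hb pq h, add_zero]
  smul_mem' := fun c x hx pq h => by
    rw [DirectSum.smul_apply, hx pq h, smul_zero]

/-- The first filtration: `F^p` is the part of the total module in the columns `≤ p`. -/
def filtI (K : DoubleComplex.{u}) (p : ℤ) : Submodule ℤ K.Tot where
  carrier := {x | ∀ ij : ℕ × ℕ, p < (ij.1 : ℤ) → x ij = 0}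
  zero_mem' := fun _ _ => rfl
  add_mem' := fun {a b} ha hb pq h => by
    rw [DirectSum.add_apply, ha pq h, hb pq h, add_zero]
  smul_mem' := fun c x hx pq h => by
    rw [DirectSum.smul_apply, hx pq h, smul_zero]

/-- The cycles of degree `n` of the total complex. -/
noncomputable def totCycles (K : DoubleComplex.{u}) (n : ℤ) : Submodule ℤ K.Tot :=
  K.totDeg n ⊓ LinearMap.ker K.totD

/-- The boundaries of degree `n` of the total complex. -/
noncomputable def totBoundaries (K : DoubleComplex.{u}) (n : ℤ) : Submodule ℤ K.Tot :=
  (K.totDeg (n + 1)).map K.totD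

/-- `H_n(Tot(C))`. -/
abbrev totHomology (K : DoubleComplex.{u}) (n : ℤ) : Type u :=
  K.totCycles n ⧸ (K.totBoundaries n).submoduleOf (K.totCycles n)

/-- `Z^r_{p,q} = {x ∈ F^p Tot_{p+q} | D x ∈ F^{p-r}}`. -/
noncomputable def ssCycles (K : DoubleComplex.{u}) (r p q : ℤ) : Submodule ℤ K.Tot :=
  (K.totDeg (p + q) ⊓ K.filtI p) ⊓ (K.filtI (p - r)).comap K.totD

/-- `Z^{r-1}_{p-1,q+1} + D Z^{r-1}_{p+r-1,q-r+2}`. -/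
noncomputable def ssBoundaries (K : DoubleComplex.{u}) (r p q : ℤ) : Submodule ℤ K.Tot :=
  K.ssCycles (r - 1) (p - 1) (q + 1) ⊔
    (K.ssCycles (r - 1) (p + r - 1) (q - r + 2)).map K.totD

/-- The term `E^r_{p,q}` (`r ≥ 1`) of the first spectral sequence of the double complex, that is,
of the spectral sequence of the total complex with its first filtration:
`E^r_{p,q} = Z^r_{p,q} / (Z^{r-1}_{p-1,q+1} + D Z^{r-1}_{p+r-1,q-r+2})`. -/
abbrev firstSS (K : DoubleComplex.{u}) (r p q : ℤ) : Type u :=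
  K.ssCycles r p q ⧸ (K.ssBoundaries r p q).submoduleOf (K.ssCycles r p q)

/-- The first spectral sequence collapses onto the `p`-axis: `E^2_{p,q} = 0` for `q ≠ 0`. -/
def FirstSSCollapsesOntoPAxis (K : DoubleComplex.{u}) : Prop :=
  ∀ p q : ℤ, q ≠ 0 → Subsingleton (K.firstSS 2 p q)

end DoubleComplex

/-! ### Simplicial chains -/

section Chains

variable {V : Type u} {V' : Type v}

/-- An ordered `n`-simplex of a simplicial complex: an enumeration `[v_0, …, v_n]` of the
(distinct) vertices of one of its `n`-simplices. -/
def OrderedSimplex (K : PreAbstractSimplicialComplex V) (n : ℕ) : Type u :=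
  {s : Fin (n + 1) ↪ V // Finset.univ.map s ∈ K.faces}

namespace OrderedSimplex

/-- The face `[v_0, …, v̂_i, …, v_{n+1}]`. -/
def face {K : PreAbstractSimplicialComplex V} {n : ℕ} (i : Fin (n + 2))
    (s : OrderedSimplex K (n + 1)) : OrderedSimplex K n :=
  ⟨i.succAboveEmb.trans s.1, (K.isRelLowerSet_faces s.2).2
    (by
      rw [← Finset.map_map]
      exact Finset.map_subset_map.2 (Finset.subset_univ _))
    (by simp)⟩

/-- The reordering `[v_{σ 0}, …, v_{σ n}]`. -/
def perm {K : PreAbstractSimplicialComplex V} {n : ℕ} (σ : Equiv.Perm (Fin (n + 1)))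
    (s : OrderedSimplex K n) : OrderedSimplex K n :=
  ⟨σ.toEmbedding.trans s.1, by
    have h : (Finset.univ : Finset (Fin (n + 1))).map (σ.toEmbedding.trans s.1)
        = Finset.univ.map s.1 := by
      rw [← Finset.map_map, Finset.map_univ_equiv]
    rw [h]; exact s.2⟩

end OrderedSimplex

/-- A (vertex map of a) simplicial map which is injective on every simplex. -/
structure NondegMap (K : PreAbstractSimplicialComplex V) (K' : PreAbstractSimplicialComplex V') where
  toFun : V → V'
  injOn : ∀ t ∈ K.faces, Set.InjOn toFun t
  image_mem : ∀ t ∈ K.faces, ∃ t' ∈ K'.faces, (t' : Set V') = toFun '' t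

/-- The image `[g v_0, …, g v_n]` of an ordered simplex. -/
def OrderedSimplex.map {K : PreAbstractSimplicialComplex V} {K' : PreAbstractSimplicialComplex V'}
    (g : NondegMap K K') {n : ℕ} (s : OrderedSimplex K n) : OrderedSimplex K' n :=
  ⟨⟨fun i => g.toFun (s.1 i), fun i j h =>
      s.1.injective (g.injOn _ s.2 (by simp) (by simp) h)⟩, by
    obtain ⟨t', h1, h2⟩ := g.image_mem _ s.2
    convert h1
    apply Finset.coe_injective
    rw [h2]
    ext x
    simp only [Finset.coe_map, Finset.coe_univ, Set.image_univ, Set.mem_range, Set.mem_image,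
      exists_exists_eq_and]
    rfl⟩

/-- The two conventions for the group of simplicial `n`-chains: `ordered`, the free abelian group
on the ordered `n`-simplices; and `oriented`, its quotient by the relations
`[v_{σ 0}, …, v_{σ n}] = sign σ [v_0, …, v_n]`. -/
inductive ChainConvention
  | ordered
  | oriented

/-- The relations imposed on the free abelian group on the ordered `n`-simplices. -/
noncomputable def chainRel (κ : ChainConvention) (K : PreAbstractSimplicialComplex V) (n : ℕ) :
    Submodule ℤ (OrderedSimplex K n →₀ ℤ) :=
  match κ with
  | .ordered => ⊥
  | .oriented => Submodule.span ℤ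
      {x | ∃ (s : OrderedSimplex K n) (σ : Equiv.Perm (Fin (n + 1))),
        x = Finsupp.single (s.perm σ) 1 - (Equiv.Perm.sign σ : ℤ) • Finsupp.single s 1}

/-- The group `C_n(K)` of simplicial `n`-chains of `K`. -/
abbrev Chain (κ : ChainConvention) (K : PreAbstractSimplicialComplex V) (n : ℕ) : Type u :=
  (OrderedSimplex K n →₀ ℤ) ⧸ chainRel κ K n

/-- The `i`-th face operator on free chains. -/
noncomputable def freeFace (K : PreAbstractSimplicialComplex V) (n : ℕ) (i : Fin (n + 2)) :
    (OrderedSimplex K (n + 1) →₀ ℤ) →ₗ[ℤ] (OrderedSimplex K n →₀ ℤ) :=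
  Finsupp.lmapDomain ℤ ℤ (OrderedSimplex.face i)

/-- `∂ [v_0, …, v_{n+1}] = ∑ (-1)^i [v_0, …, v̂_i, …, v_{n+1}]` on free chains. -/
noncomputable def freeBoundary (K : PreAbstractSimplicialComplex V) (n : ℕ) :
    (OrderedSimplex K (n + 1) →₀ ℤ) →ₗ[ℤ] (OrderedSimplex K n →₀ ℤ) :=
  ∑ i : Fin (n + 2), (-1 : ℤ) ^ (i : ℕ) • freeFace K n i

theorem face_perm {K : PreAbstractSimplicialComplex V} {n : ℕ} (σ : Equiv.Perm (Fin (n + 2)))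
    (i : Fin (n + 2)) (s : OrderedSimplex K (n + 1)) :
    ∃ τ : Equiv.Perm (Fin (n + 1)), (s.perm σ).face i = (s.face (σ i)).perm τ ∧
      (Equiv.Perm.sign τ : ℤ) = (-1) ^ ((σ i : ℕ) + (i : ℕ)) * (Equiv.Perm.sign σ : ℤ) := by
  set ρ : Equiv.Perm (Fin (n + 2)) := (σ i).cycleRange * σ * i.cycleRange⁻¹ with hρ
  have h0 : ρ 0 = 0 := by
    simp [hρ]
  obtain ⟨⟨p, τ⟩, hτ⟩ := Equiv.Perm.decomposeFin.symm.surjective ρ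
  have hp : p = 0 := by
    rw [← hτ, Equiv.Perm.decomposeFin_symm_apply_zero] at h0
    exact h0
  subst hp
  refine ⟨τ, ?_, ?_⟩
  · apply Subtype.ext
    ext j
    have h1 : ρ j.succ = (τ j).succ := by
      rw [← hτ, Equiv.Perm.decomposeFin_symm_apply_succ]; simp
    have h2 : σ (i.succAbove j) = (σ i).succAbove (τ j) := by
      rw [← Fin.cycleRange_symm_succ (σ i) (τ j), ← h1, hρ]
      simp
    simp [OrderedSimplex.face, OrderedSimplex.perm, h2]
  · have h4 : Equiv.Perm.sign ρ = Equiv.Perm.sign τ := by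
      rw [← hτ, Equiv.Perm.decomposeFin.symm_sign]; simp
    rw [← h4, hρ]
    simp [Fin.sign_cycleRange, pow_add]
    ring

theorem freeBoundary_mem (κ : ChainConvention) (K : PreAbstractSimplicialComplex V) (n : ℕ) :
    chainRel κ K (n + 1) ≤ (chainRel κ K n).comap (freeBoundary K n) := by
  cases κ with
  | ordered => exact bot_le
  | oriented =>
    refine Submodule.span_le.2 ?_
    rintro _ ⟨s, σ, rfl⟩
    rw [SetLike.mem_coe, Submodule.mem_comap, map_sub, map_smul]
    simp only [freeBoundary, LinearMap.sum_apply, LinearMap.smul_apply, freeFace,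
      Finsupp.lmapDomain_apply, Finsupp.mapDomain_single]
    rw [← Equiv.sum_comp σ (fun i => (-1 : ℤ) ^ (i : ℕ) • Finsupp.single (s.face i) (1 : ℤ)),
      Finset.smul_sum, ← Finset.sum_sub_distrib]
    refine Submodule.sum_mem _ fun i _ => ?_
    obtain ⟨τ, h1, h2⟩ := face_perm σ i s
    rw [h1]
    have key : (-1 : ℤ) ^ (i : ℕ) • Finsupp.single ((s.face (σ i)).perm τ) (1 : ℤ)
        - (Equiv.Perm.sign σ : ℤ) • (-1 : ℤ) ^ (σ i : ℕ) • Finsupp.single (s.face (σ i)) (1 : ℤ)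
        = (-1 : ℤ) ^ (i : ℕ) • (Finsupp.single ((s.face (σ i)).perm τ) (1 : ℤ)
          - (Equiv.Perm.sign τ : ℤ) • Finsupp.single (s.face (σ i)) (1 : ℤ)) := by
      rw [smul_sub, h2, smul_smul, smul_smul]
      congr 2
      rw [pow_add, mul_comm ((-1 : ℤ) ^ (σ i : ℕ)), ← mul_assoc, ← mul_assoc, ← pow_add,
        Even.neg_one_pow ⟨_, rfl⟩]
      ring
    rw [key]
    exact Submodule.smul_mem _ _ (Submodule.subset_span ⟨_, _, rfl⟩)

/-- The boundary map `∂ : C_{n+1}(K) → C_n(K)`. -/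
noncomputable def boundary (κ : ChainConvention) (K : PreAbstractSimplicialComplex V) (n : ℕ) :
    Chain κ K (n + 1) →ₗ[ℤ] Chain κ K n :=
  Submodule.mapQ _ _ (freeBoundary K n) (freeBoundary_mem κ K n)

/-- The induced map on free chains. -/
noncomputable def freeMap {K : PreAbstractSimplicialComplex V}
    {K' : PreAbstractSimplicialComplex V'} (g : NondegMap K K') (n : ℕ) :
    (OrderedSimplex K n →₀ ℤ) →ₗ[ℤ] (OrderedSimplex K' n →₀ ℤ) :=
  Finsupp.lmapDomain ℤ ℤ (OrderedSimplex.map g)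

theorem freeMap_mem (κ : ChainConvention) {K : PreAbstractSimplicialComplex V}
    {K' : PreAbstractSimplicialComplex V'} (g : NondegMap K K') (n : ℕ) :
    chainRel κ K n ≤ (chainRel κ K' n).comap (freeMap g n) := by
  cases κ with
  | ordered => exact bot_le
  | oriented =>
    refine Submodule.span_le.2 ?_
    rintro _ ⟨s, σ, rfl⟩
    refine Submodule.subset_span ⟨s.map g, σ, ?_⟩
    rw [map_sub, map_smul]
    simp only [freeMap, Finsupp.lmapDomain_apply, Finsupp.mapDomain_single]
    rfl

/-- The induced map `g_# : C_n(K) → C_n(K')`. -/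
noncomputable def chainMap (κ : ChainConvention) {K : PreAbstractSimplicialComplex V}
    {K' : PreAbstractSimplicialComplex V'} (g : NondegMap K K') (n : ℕ) :
    Chain κ K n →ₗ[ℤ] Chain κ K' n :=
  Submodule.mapQ _ _ (freeMap g n) (freeMap_mem κ g n)

/-- An alternating sum of operators that satisfy the (semi)simplicial identities squares to 0. -/
theorem alternating_sum_sq {A B C : Type*} [AddCommGroup A] [AddCommGroup B] [AddCommGroup C]
    (m : ℕ) (a : Fin (m + 3) → A →ₗ[ℤ] B) (b : Fin (m + 2) → B →ₗ[ℤ] C)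
    (h : ∀ i j : Fin (m + 2), i ≤ j → (b i).comp (a j.succ) = (b j).comp (a i.castSucc)) :
    (∑ i : Fin (m + 2), (-1 : ℤ) ^ (i : ℕ) • b i).comp
        (∑ j : Fin (m + 3), (-1 : ℤ) ^ (j : ℕ) • a j) = 0 := by
  have e : (∑ i : Fin (m + 2), (-1 : ℤ) ^ (i : ℕ) • b i).comp
        (∑ j : Fin (m + 3), (-1 : ℤ) ^ (j : ℕ) • a j)
      = ∑ ij : Fin (m + 2) × Fin (m + 3),
        (-1 : ℤ) ^ (ij.1 + ij.2 : ℕ) • (b ij.1).comp (a ij.2) := by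
    rw [Fintype.sum_prod_type]
    ext x
    simp [LinearMap.sum_apply, Finset.smul_sum, map_sum, smul_smul, pow_add]
  rw [e]
  let P := Fin (m + 2) × Fin (m + 3)
  let S : Finset P := {ij : P | (ij.2 : ℕ) ≤ (ij.1 : ℕ)}
  rw [← Finset.sum_add_sum_compl S, ← eq_neg_iff_add_eq_zero, ← Finset.sum_neg_distrib]
  let φ : ∀ ij : P, ij ∈ S → P := fun ij hij =>
    (Fin.castLT ij.2 (lt_of_le_of_lt (Finset.mem_filter.mp hij).right (Fin.is_lt ij.1)), ij.1.succ)
  apply Finset.sum_bij φ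
  · intro ij hij
    simp_rw [S, φ, Finset.compl_filter, Finset.mem_filter_univ, Fin.val_succ,
      Fin.val_castLT] at hij ⊢
    lia
  · rintro ⟨i, j⟩ hij ⟨i', j'⟩ hij' h
    rw [Prod.mk_inj]
    exact ⟨by simpa [φ] using! congr_arg Prod.snd h,
      by simpa [φ, Fin.castSucc_castLT] using! congr_arg Fin.castSucc (congr_arg Prod.fst h)⟩
  · rintro ⟨i', j'⟩ hij'
    simp_rw [S, Finset.compl_filter, Finset.mem_filter_univ, not_le] at hij'
    refine ⟨(j'.pred <| ?_, Fin.castSucc i'), ?_, ?_⟩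
    · rintro rfl
      simp only [Fin.val_zero, not_lt_zero] at hij'
    · simpa [S] using! Nat.le_sub_one_of_lt hij'
    · simp only [φ, Fin.castLT_castSucc, Fin.succ_pred]
  · rintro ⟨i, j⟩ hij
    have hij' : (j : ℕ) ≤ i := by simpa [S] using hij
    have hh := h (Fin.castLT j (lt_of_le_of_lt hij' i.is_lt)) i hij'
    rw [Fin.castSucc_castLT] at hh
    simp only [φ, Fin.val_succ, Fin.val_castLT]
    rw [hh, ← neg_smul]
    congr 1
    ring

theorem succAbove_comm {m : ℕ} (i j : Fin (m + 1)) (h : i ≤ j) (k : Fin m) :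
    j.succ.succAbove (i.succAbove k) = i.castSucc.succAbove (j.succAbove k) := by
  have h' : (i : ℕ) ≤ j := h
  ext
  simp only [Fin.succAbove, Fin.lt_def, Fin.val_castSucc, Fin.val_succ]
  split_ifs <;> simp_all <;> omega

theorem freeBoundary_sq (K : PreAbstractSimplicialComplex V) (n : ℕ) :
    (freeBoundary K n).comp (freeBoundary K (n + 1)) = 0 := by
  refine alternating_sum_sq n _ _ fun i j hij => ?_
  ext1 s
  ext1
  simp only [freeFace, LinearMap.comp_apply, Finsupp.lsingle_apply, Finsupp.lmapDomain_apply,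
    Finsupp.mapDomain_single]
  congr 1
  apply Subtype.ext
  ext k
  simp [OrderedSimplex.face, succAbove_comm i j hij k]

theorem boundary_boundary (κ : ChainConvention) (K : PreAbstractSimplicialComplex V) (n : ℕ)
    (x : Chain κ K (n + 2)) : boundary κ K n (boundary κ K (n + 1) x) = 0 := by
  obtain ⟨y, rfl⟩ := Submodule.mkQ_surjective _ x
  have := LinearMap.congr_fun (freeBoundary_sq K n) y
  simp only [boundary, Submodule.mkQ_apply, Submodule.mapQ_apply]
  rw [LinearMap.comp_apply] at this
  rw [this]; rfl

theorem boundary_chainMap (κ : ChainConvention) {K : PreAbstractSimplicialComplex V}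
    {K' : PreAbstractSimplicialComplex V'} (g : NondegMap K K') (n : ℕ) (x : Chain κ K (n + 1)) :
    boundary κ K' n (chainMap κ g (n + 1) x) = chainMap κ g n (boundary κ K n x) := by
  obtain ⟨y, rfl⟩ := Submodule.mkQ_surjective _ x
  have : (freeBoundary K' n).comp (freeMap g (n + 1)) = (freeMap g n).comp (freeBoundary K n) := by
    ext1 s
    ext1
    simp only [freeBoundary, LinearMap.comp_apply, LinearMap.sum_apply, LinearMap.smul_apply,
      freeFace, freeMap, map_sum, map_smul, Finsupp.lsingle_apply, Finsupp.lmapDomain_apply,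
      Finsupp.mapDomain_single]
    rfl
  have := LinearMap.congr_fun this y
  simp only [boundary, chainMap, Submodule.mkQ_apply, Submodule.mapQ_apply]
  rw [LinearMap.comp_apply, LinearMap.comp_apply] at this
  rw [this]

/-- Compositions of induced maps agree if the compositions of the vertex maps do. -/
theorem chainMap_chainMap_eq (κ : ChainConvention) {V₁ V₂ V₃ V₄ : Type*}
    {K₁ : PreAbstractSimplicialComplex V₁} {K₂ : PreAbstractSimplicialComplex V₂}
    {K₃ : PreAbstractSimplicialComplex V₃} {K₄ : PreAbstractSimplicialComplex V₄}
    (g : NondegMap K₁ K₂) (h : NondegMap K₂ K₄) (g' : NondegMap K₁ K₃) (h' : NondegMap K₃ K₄)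
    (e : ∀ v, h.toFun (g.toFun v) = h'.toFun (g'.toFun v)) (n : ℕ) (x : Chain κ K₁ n) :
    chainMap κ h n (chainMap κ g n x) = chainMap κ h' n (chainMap κ g' n x) := by
  obtain ⟨y, rfl⟩ := Submodule.mkQ_surjective _ x
  have : (freeMap h n).comp (freeMap g n) = (freeMap h' n).comp (freeMap g' n) := by
    ext1 s
    ext1
    simp only [LinearMap.comp_apply, freeMap, Finsupp.lsingle_apply, Finsupp.lmapDomain_apply,
      Finsupp.mapDomain_single]
    congr 1
    apply Subtype.ext
    ext k
    exact e _
  have := LinearMap.congr_fun this y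
  simp only [chainMap, Submodule.mkQ_apply, Submodule.mapQ_apply]
  rw [LinearMap.comp_apply, LinearMap.comp_apply] at this
  rw [this]

theorem exists_perm_eq {K : PreAbstractSimplicialComplex V} {n : ℕ} (s s' : OrderedSimplex K n)
    (h : Finset.univ.map s.1 = Finset.univ.map s'.1) :
    ∃ σ : Equiv.Perm (Fin (n + 1)), s = s'.perm σ := by
  have hr : Set.range s.1 = Set.range s'.1 := by
    have := congrArg (fun t : Finset V => (t : Set V)) h
    simpa using this
  let σ : Equiv.Perm (Fin (n + 1)) := (Equiv.ofInjective s.1 s.1.injective).trans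
    ((Equiv.setCongr hr).trans (Equiv.ofInjective s'.1 s'.1.injective).symm)
  refine ⟨σ, Subtype.ext ?_⟩
  ext i
  have : s'.1 (σ i) = s.1 i := Equiv.apply_ofInjective_symm s'.1.injective _
  exact this.symm

theorem perm_injective {K : PreAbstractSimplicialComplex V} {n : ℕ} (s : OrderedSimplex K n)
    {σ τ : Equiv.Perm (Fin (n + 1))} (h : s.perm σ = s.perm τ) : σ = τ := by
  ext1 i
  have h1 := DFunLike.congr_fun (congrArg Subtype.val h) i
  exact s.1.injective h1

theorem map_univ_perm {K : PreAbstractSimplicialComplex V} {n : ℕ} (s : OrderedSimplex K n)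
    (σ : Equiv.Perm (Fin (n + 1))) : Finset.univ.map (s.perm σ).1 = Finset.univ.map s.1 := by
  change Finset.univ.map (σ.toEmbedding.trans s.1) = _
  rw [← Finset.map_map, Finset.map_univ_equiv]

/-- The chain groups have no 2-torsion. -/
theorem chain_eq_zero_of_two_smul (κ : ChainConvention) (K : PreAbstractSimplicialComplex V)
    (n : ℕ) (x : Chain κ K n) (h : x + x = 0) : x = 0 := by
  obtain ⟨y, rfl⟩ := Submodule.mkQ_surjective _ x
  rw [← map_add, Submodule.mkQ_apply, Submodule.Quotient.mk_eq_zero] at h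
  rw [Submodule.mkQ_apply, Submodule.Quotient.mk_eq_zero]
  have tf : ∀ z : OrderedSimplex K n →₀ ℤ, z + z = 0 → z = 0 := fun z hz => by
    ext s
    have := DFunLike.congr_fun hz s
    simp only [Finsupp.coe_add, Pi.add_apply, Finsupp.coe_zero, Pi.zero_apply] at this ⊢
    omega
  cases κ with
  | ordered => exact tf y h
  | oriented =>
    let g : OrderedSimplex K n → Finset V := fun s => Finset.univ.map s.1
    let ref : OrderedSimplex K n → OrderedSimplex K n :=
      fun s => Set.rangeSplitting g ⟨g s, s, rfl⟩
    have href : ∀ s, g (ref s) = g s := fun s => Set.apply_rangeSplitting g ⟨g s, s, rfl⟩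
    have href' : ∀ s (σ : Equiv.Perm (Fin (n + 1))), ref (s.perm σ) = ref s := fun s σ => by
      have : g (s.perm σ) = g s := map_univ_perm s σ
      simp only [ref, this]
    choose τ hτ using fun s => exists_perm_eq s (ref s) (href s).symm
    let φ : (OrderedSimplex K n →₀ ℤ) →ₗ[ℤ] (OrderedSimplex K n →₀ ℤ) :=
      Finsupp.linearCombination ℤ fun s =>
        (Equiv.Perm.sign (τ s) : ℤ) • Finsupp.single (ref s) (1 : ℤ)
    have hφ : chainRel .oriented K n ≤ LinearMap.ker φ := by
      refine Submodule.span_le.2 ?_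
      rintro _ ⟨s, σ, rfl⟩
      have e : τ (s.perm σ) = τ s * σ := by
        apply perm_injective (ref s)
        rw [← href' s σ, ← hτ (s.perm σ), href' s σ]
        conv_lhs => rw [hτ s]
        rfl
      rw [SetLike.mem_coe, LinearMap.mem_ker, map_sub, map_smul]
      simp only [φ, Finsupp.linearCombination_single, e, href', smul_smul,
        Equiv.Perm.sign_mul, Units.val_mul]
      rw [sub_eq_zero]
      congr 1
      ring
    have hφ' : ∀ z, z - φ z ∈ chainRel .oriented K n := by
      intro z
      induction z using Finsupp.induction_linear with
      | zero => simp
      | add a b ha hb =>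
        rw [map_add, add_sub_add_comm]
        exact Submodule.add_mem _ ha hb
      | single s m =>
        have : Finsupp.single s m - φ (Finsupp.single s m)
            = m • (Finsupp.single ((ref s).perm (τ s)) (1 : ℤ)
              - (Equiv.Perm.sign (τ s) : ℤ) • Finsupp.single (ref s) (1 : ℤ)) := by
          rw [← hτ s, smul_sub]
          simp [φ]
        rw [this]
        exact Submodule.smul_mem _ _ (Submodule.subset_span ⟨_, _, rfl⟩)
    have h1 : φ y = 0 := by
      apply tf
      rw [← map_add]
      exact hφ h
    simpa [h1] using hφ' y

/-- The `n`-cycles of the simplicial chain complex `C_•(K)`. -/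
noncomputable def cycles (κ : ChainConvention) (K : PreAbstractSimplicialComplex V) :
    ∀ n : ℕ, Submodule ℤ (Chain κ K n)
  | 0 => ⊤
  | n + 1 => LinearMap.ker (boundary κ K n)

/-- `H_n(K)`, the homology of the simplicial chain complex `C_•(K)`. -/
abbrev simplicialHomology (κ : ChainConvention) (K : PreAbstractSimplicialComplex V) (n : ℕ) :
    Type u :=
  cycles κ K n ⧸ (LinearMap.range (boundary κ K n)).submoduleOf (cycles κ K n)

end Chains

/-! ### Simplicial maps and their multiple point spaces -/

section MultiplePoints

variable {E : Type u} {F : Type v} [NormedAddCommGroup E] [NormedSpace ℝ E]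

/-- Every point of `|X|` has a neighbourhood which meets only finitely many simplices. -/
def IsLocallyFinite (X : Geometry.SimplicialComplex ℝ E) : Prop :=
  ∀ x ∈ X.space, ∃ U ∈ 𝓝 x,
    {s : Finset E | s ∈ X.faces ∧ (convexHull ℝ (s : Set E) ∩ U).Nonempty}.Finite

/-- `f` restricts to a simplicial map `|X| → |Y|`: it maps the vertices of each simplex of `X` to
the vertices of a simplex of `Y`, and it is affine on each simplex of `X`. Only the restriction of
`f` to `|X|` matters. -/
structure IsSimplicialMap [NormedAddCommGroup F] [NormedSpace ℝ F]
    (X : Geometry.SimplicialComplex ℝ E) (Y : Geometry.SimplicialComplex ℝ F) (f : E → F) : Prop where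
  image_mem : ∀ s ∈ X.faces, ∃ t ∈ Y.faces, (t : Set F) = f '' s
  affine : ∀ s ∈ X.faces, ∀ w : E → ℝ, (∀ a ∈ s, 0 ≤ w a) → ∑ a ∈ s, w a = 1 →
    f (∑ a ∈ s, w a • a) = ∑ a ∈ s, w a • f a

/-- The triangulation of the fibred product
`W^k(f) = {(x_1, …, x_k) ∈ X^k | f x_1 = … = f x_k}` (`k ≥ 1`) associated to the simplicial map
`f`. Its simplices are those with vertices
`(v_0^(1), …, v_0^(k)), …, (v_n^(1), …, v_n^(k))` where, for each `ℓ`, the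
`v_0^(ℓ), …, v_n^(ℓ)` are the distinct vertices of a simplex of `X`, and where
`f v_j^(1) = … = f v_j^(k)` for each `j`. -/
def W (X : Geometry.SimplicialComplex ℝ E) (f : E → F) (k : ℕ) :
    PreAbstractSimplicialComplex (Fin k → E) where
  faces := {t | t.Nonempty ∧
    (∀ l, Set.InjOn (fun x : Fin k → E => x l) t ∧
      ∃ s ∈ X.faces, (s : Set E) = (fun x : Fin k → E => x l) '' t) ∧
    ∀ x ∈ t, ∀ l l', f (x l) = f (x l')}
  isRelLowerSet_faces := by
    rintro t ⟨h0, h1, h2⟩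
    refine ⟨h0, fun s hst hs => ⟨hs, fun l => ⟨(h1 l).1.mono (by exact_mod_cast hst), ?_⟩,
      fun x hx => h2 x (hst hx)⟩⟩
    classical
    obtain ⟨s', h3, h4⟩ := (h1 l).2
    refine ⟨s.image (fun x => x l), X.down_closed h3 ?_ (hs.image _), by simp⟩
    rw [← Finset.coe_subset, h4, Finset.coe_image]
    exact Set.image_mono (by exact_mod_cast hst)

/-- The set `D_S^k(f)` of strict multiple points. -/
def strictMultiplePoints (X : Geometry.SimplicialComplex ℝ E) (f : E → F) (k : ℕ) :
    Set (Fin k → E) :=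
  {x | (∀ i, x i ∈ X.space) ∧ (∀ i j, i ≠ j → x i ≠ x j) ∧ ∀ i j, f (x i) = f (x j)}

/-- The multiple point space `D^k(f)`: the closure of `D_S^k(f)` in `|X|^k`. -/
def multiplePointSpace (X : Geometry.SimplicialComplex ℝ E) (f : E → F) (k : ℕ) :
    Set (Fin k → E) :=
  closure (strictMultiplePoints X f k) ∩ {x | ∀ i, x i ∈ X.space}

/-- The triangulation of `D^k(f)` associated to the simplicial map `f`: the subcomplex of that of
`W^k(f)` which consists of the simplices contained in `D^k(f)`. -/
def D (X : Geometry.SimplicialComplex ℝ E) (f : E → F) (k : ℕ) :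
    PreAbstractSimplicialComplex (Fin k → E) where
  faces := {t | t ∈ (W X f k).faces ∧ convexHull ℝ (t : Set (Fin k → E)) ⊆ multiplePointSpace X f k}
  isRelLowerSet_faces := by
    rintro t ⟨h0, h1⟩
    refine ⟨((W X f k).isRelLowerSet_faces h0).1, fun s hst hs =>
      ⟨((W X f k).isRelLowerSet_faces h0).2 hst hs, ?_⟩⟩
    exact (convexHull_mono (by exact_mod_cast hst)).trans h1

/-- Reindexing the components by an injection `e`, as a map `X^k → X^m`, respects the simplices of
the `W^k(f)`. -/
theorem W_reindex (X : Geometry.SimplicialComplex ℝ E) (f : E → F) {k m : ℕ} (e : Fin m → Fin k)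
    (t : Finset (Fin k → E)) (ht : t ∈ (W X f k).faces) :
    ∃ t' ∈ (W X f m).faces,
      (t' : Set (Fin m → E)) = (fun (x : Fin k → E) (l : Fin m) => x (e l)) '' t := by
  classical
  obtain ⟨h0, h1, h2⟩ := ht
  refine ⟨t.image fun x l => x (e l), ⟨h0.image _, fun l => ⟨?_, ?_⟩, ?_⟩, Finset.coe_image⟩
  · rw [Finset.coe_image]
    rintro _ ⟨x, hx, rfl⟩ _ ⟨y, hy, rfl⟩ hxy
    rw [(h1 (e l)).1 hx hy hxy]
  · obtain ⟨s, h3, h4⟩ := (h1 (e l)).2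
    refine ⟨s, h3, ?_⟩
    rw [h4, Finset.coe_image, Set.image_image]
  · intro y hy l l'
    obtain ⟨x, hx, rfl⟩ := Finset.mem_image.1 hy
    exact h2 x hx _ _

theorem D_reindex (X : Geometry.SimplicialComplex ℝ E) (f : E → F) {k m : ℕ} (e : Fin m → Fin k)
    (he : Function.Injective e) (t : Finset (Fin k → E)) (ht : t ∈ (D X f k).faces) :
    ∃ t' ∈ (D X f m).faces,
      (t' : Set (Fin m → E)) = (fun (x : Fin k → E) (l : Fin m) => x (e l)) '' t := by
  obtain ⟨t', h1, h2⟩ := W_reindex X f e t ht.1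
  refine ⟨t', ⟨h1, ?_⟩, h2⟩
  have h := (LinearMap.funLeft ℝ E e).image_convexHull (t : Set (Fin k → E))
  rw [h2]
  refine h.symm.subset.trans ?_
  rintro _ ⟨x, hx, rfl⟩
  obtain ⟨h3, h4⟩ := ht.2 hx
  refine ⟨?_, fun l => h4 _⟩
  have hc : Continuous fun (x : Fin k → E) (l : Fin m) => x (e l) := by fun_prop
  refine map_mem_closure hc h3 ?_
  rintro z ⟨z1, z2, z3⟩
  exact ⟨fun l => z1 _, fun l l' h => z2 _ _ fun h' => h (he h'), fun l l' => z3 _ _⟩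

/-- The projection `ε^i : W^k(f) → W^{k-1}(f)`, `k = q + 2`, which forgets the `i`-th
component. -/
def WProj (X : Geometry.SimplicialComplex ℝ E) (f : E → F) (q : ℕ) (i : Fin (q + 2)) :
    NondegMap (W X f (q + 2)) (W X f (q + 1)) where
  toFun := fun x l => x (i.succAbove l)
  injOn := by
    rintro t ⟨_, h1, _⟩ x hx y hy hxy
    exact (h1 (i.succAbove 0)).1 hx hy (congrFun hxy 0)
  image_mem := W_reindex X f i.succAbove

/-- The projection `ε^k : D^k(f) → D^{k-1}(f)`, `k = q + 2`, which forgets the last component. -/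
def DProj (X : Geometry.SimplicialComplex ℝ E) (f : E → F) (q : ℕ) :
    NondegMap (D X f (q + 2)) (D X f (q + 1)) where
  toFun := fun x l => x l.castSucc
  injOn := by
    rintro t ⟨⟨_, h1, _⟩, _⟩ x hx y hy hxy
    exact (h1 (Fin.castSucc 0)).1 hx hy (congrFun hxy 0)
  image_mem := D_reindex X f Fin.castSucc (Fin.castSucc_injective _)

/-- The action of a permutation `σ ∈ S_k` on `D^k(f)`,
`(x_1, …, x_k) ↦ (x_{σ 1}, …, x_{σ k})`. -/
def DPerm (X : Geometry.SimplicialComplex ℝ E) (f : E → F) (k : ℕ) (σ : Equiv.Perm (Fin k)) :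
    NondegMap (D X f k) (D X f k) where
  toFun := fun x l => x (σ l)
  injOn := fun t _ x _ y _ hxy => by
    funext l
    simpa using congrFun hxy (σ.symm l)
  image_mem := D_reindex X f σ σ.injective

/-- `ρ = ∑_i (-1)^{i-1} ε^i_# : C_n(W^k(f)) → C_n(W^{k-1}(f))` for `k = q + 2`. -/
noncomputable def rho (κ : ChainConvention) (X : Geometry.SimplicialComplex ℝ E) (f : E → F)
    (n q : ℕ) : Chain κ (W X f (q + 2)) n →ₗ[ℤ] Chain κ (W X f (q + 1)) n :=
  ∑ i : Fin (q + 2), (-1 : ℤ) ^ (i : ℕ) • chainMap κ (WProj X f q i) n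

/-- The double complex `(C_n(W^{k+1}(f)), ∂, ϱ)` with `ϱ = (-1)^n ρ`; here `n = p` and `k = q`. -/
noncomputable def WDoubleComplex (κ : ChainConvention) (X : Geometry.SimplicialComplex ℝ E)
    (f : E → F) : DoubleComplex.{u} where
  C := fun p q => Chain κ (W X f (q + 1)) p
  d' := fun p q => boundary κ (W X f (q + 1)) p
  d'' := fun p q => (-1 : ℤ) ^ p • rho κ X f p q
  d'_d' := fun p q x => boundary_boundary κ _ p x
  d''_d'' := fun p q x => by
    have h : (rho κ X f p q).comp (rho κ X f p (q + 1)) = 0 := by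
      refine alternating_sum_sq q _ _ fun i j hij => ?_
      refine LinearMap.ext fun y => ?_
      refine chainMap_chainMap_eq κ _ _ _ _ (fun v => ?_) p y
      funext l
      exact congrArg v (succAbove_comm i j hij l)
    have := LinearMap.congr_fun h x
    rw [LinearMap.comp_apply] at this
    simp [LinearMap.smul_apply, this]
  anticomm := fun p q x => by
    have h : boundary κ (W X f (q + 1)) p (rho κ X f (p + 1) q x)
        = rho κ X f p q (boundary κ (W X f (q + 2)) p x) := by
      simp only [rho, LinearMap.sum_apply, LinearMap.smul_apply, map_sum, map_smul,
        boundary_chainMap]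
    rw [LinearMap.smul_apply, LinearMap.smul_apply, map_smul, h, ← add_smul, pow_succ]
    simp

/-- The alternating chains
`C_n^Alt(D^k(f)) = {c ∈ C_n(D^k(f)) | σ_# c = sign σ c for all σ ∈ S_k}`. -/
noncomputable def AltChain (κ : ChainConvention) (X : Geometry.SimplicialComplex ℝ E) (f : E → F)
    (n k : ℕ) : Submodule ℤ (Chain κ (D X f k) n) where
  carrier := {c | ∀ σ : Equiv.Perm (Fin k),
    chainMap κ (DPerm X f k σ) n c = (Equiv.Perm.sign σ : ℤ) • c}
  zero_mem' := fun σ => by rw [map_zero, smul_zero]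
  add_mem' := fun {a b} ha hb σ => by rw [map_add, ha σ, hb σ, smul_add]
  smul_mem' := fun m x hx σ => by rw [map_smul, hx σ, smul_comm]

/-- The boundary map of the alternating chain complex. -/
noncomputable def altBoundary (κ : ChainConvention) (X : Geometry.SimplicialComplex ℝ E)
    (f : E → F) (n k : ℕ) : AltChain κ X f (n + 1) k →ₗ[ℤ] AltChain κ X f n k :=
  (boundary κ (D X f k) n).restrict fun c hc σ => by
    rw [← boundary_chainMap, hc σ, map_smul]

theorem exists_perm_extension {k : ℕ} (σ : Equiv.Perm (Fin k)) :
    ∃ τ : Equiv.Perm (Fin (k + 1)), (∀ l : Fin k, τ l.castSucc = (σ l).castSucc) ∧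
      Equiv.Perm.sign τ = Equiv.Perm.sign σ :=
  ⟨σ.extendDomain (Fin.castLEquiv k.le_succ),
    fun l => σ.extendDomain_apply_image (Fin.castLEquiv k.le_succ) l,
    Equiv.Perm.sign_extendDomain _ _⟩

/-- `ε^k_# : C_n^Alt(D^k(f)) → C_n^Alt(D^{k-1}(f))` for `k = q + 2`. -/
noncomputable def altProj (κ : ChainConvention) (X : Geometry.SimplicialComplex ℝ E)
    (f : E → F) (n q : ℕ) : AltChain κ X f n (q + 2) →ₗ[ℤ] AltChain κ X f n (q + 1) :=
  (chainMap κ (DProj X f q) n).restrict fun c hc σ => by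
    obtain ⟨τ, h1, h2⟩ := exists_perm_extension σ
    rw [← h2, ← map_smul, ← hc τ]
    refine chainMap_chainMap_eq κ _ _ _ _ (fun v => ?_) n c
    funext l
    exact congrArg v (h1 l).symm

theorem altProj_altProj (κ : ChainConvention) (X : Geometry.SimplicialComplex ℝ E)
    (f : E → F) (n q : ℕ) (c : AltChain κ X f n (q + 3)) :
    altProj κ X f n q (altProj κ X f n (q + 1) c) = 0 := by
  let σ : Equiv.Perm (Fin (q + 3)) := Equiv.swap (Fin.last (q + 2)) (Fin.last (q + 1)).castSucc
  have hσ : Equiv.Perm.sign σ = -1 := Equiv.Perm.sign_swap (Fin.castSucc_lt_last _).ne'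
  have h := c.2 σ
  rw [hσ] at h
  apply Subtype.ext
  apply chain_eq_zero_of_two_smul
  have h1 : chainMap κ (DProj X f (q + 1)) n (chainMap κ (DPerm X f (q + 3) σ) n c.1)
      = -chainMap κ (DProj X f (q + 1)) n c.1 := by
    rw [h]; simp
  let g : NondegMap (D X f (q + 3)) (D X f (q + 1)) :=
    { toFun := fun x l => x l.castSucc.castSucc
      injOn := by
        rintro t ⟨⟨_, h1, _⟩, _⟩ x hx y hy hxy
        exact (h1 (Fin.castSucc (Fin.castSucc 0))).1 hx hy (congrFun hxy 0)
      image_mem := D_reindex X f (fun l => l.castSucc.castSucc)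
        ((Fin.castSucc_injective _).comp (Fin.castSucc_injective _)) }
  let i1 : NondegMap (D X f (q + 1)) (D X f (q + 1)) := DPerm X f (q + 1) 1
  have h2 : ∀ x, chainMap κ (DProj X f q) n (chainMap κ (DProj X f (q + 1)) n x)
      = chainMap κ i1 n (chainMap κ g n x) := fun x =>
    chainMap_chainMap_eq κ (DProj X f (q + 1)) (DProj X f q) g i1 (fun v => rfl) n x
  have h3 : chainMap κ g n (chainMap κ (DPerm X f (q + 3) σ) n c.1)
      = chainMap κ g n (chainMap κ (DPerm X f (q + 3) 1) n c.1) := by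
    refine chainMap_chainMap_eq κ _ _ _ _ (fun v => ?_) n c.1
    funext l
    refine congrArg v (?_ : σ l.castSucc.castSucc = l.castSucc.castSucc)
    refine Equiv.swap_apply_of_ne_of_ne ?_ ?_
    · exact (Fin.castSucc_lt_last _).ne
    · exact fun h => (Fin.castSucc_lt_last l).ne (Fin.castSucc_injective _ h)
  have h4 : chainMap κ (DPerm X f (q + 3) 1) n c.1 = c.1 := by
    have := c.2 1
    simpa using this
  rw [h4] at h3
  have h5 := congrArg (chainMap κ (DProj X f q) n) h1
  rw [map_neg, h2, h3, ← h2] at h5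
  exact eq_neg_iff_add_eq_zero.1 h5

/-- The double complex `(C_n^Alt(D^{k+1}(f)), ∂, ϵ)` with `ϵ = (-1)^n ε_#`; here `n = p` and
`k = q`. -/
noncomputable def DDoubleComplex (κ : ChainConvention) (X : Geometry.SimplicialComplex ℝ E)
    (f : E → F) : DoubleComplex.{u} where
  C := fun p q => AltChain κ X f p (q + 1)
  d' := fun p q => altBoundary κ X f p (q + 1)
  d'' := fun p q => (-1 : ℤ) ^ p • altProj κ X f p q
  d'_d' := fun p q x => Subtype.ext (boundary_boundary κ _ p x.1)
  d''_d'' := fun p q x => by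
    rw [LinearMap.smul_apply, LinearMap.smul_apply, map_smul, altProj_altProj, smul_zero, smul_zero]
  anticomm := fun p q x => by
    have h : altBoundary κ X f p (q + 1) (altProj κ X f (p + 1) q x)
        = altProj κ X f p q (altBoundary κ X f p (q + 2) x) :=
      Subtype.ext (boundary_chainMap κ (DProj X f q) p x.1)
    rw [LinearMap.smul_apply, LinearMap.smul_apply, map_smul, h, ← add_smul, pow_succ]
    simp

end MultiplePoints

end ICSS

/-!
Over an ordered simplex `y` of `Y`, let `P` be the non-empty set of ordered simplices of `X` which
`f` maps to `y`. Since `f` is injective on simplices, the ordered simplices of `W^k(f)` over `y` are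
the `k`-tuples of elements of `P`. Hence row `n` of the first double complex, augmented by `f_#` to
`C_n(Y)`, is a direct sum of augmented chain complexes of full simplices on such sets `P`; it is
contracted by the insertion of a fixed element `ℓ(y)` of `P` in front (`rho_insertChain_zero`).
Choosing a lift of each unordered simplex of `Y` makes `ℓ` compatible with reordering of vertices
(`exists_perm_lift`), so that the contraction exists in both conventions for chains.

The alternating sum of the insertions of `ℓ` in all places preserves alternating chains
(`IsAlternating.altInsertChain`) and contracts, up to sign, the complex of alternating chains of the
`W^k(f)` with the projection which forgets the last component
(`chainMap_WProj_last_altInsertChain`). The alternating chains of `W^k(f)` are those of `D^k(f)`: an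
alternating chain has coefficient zero at a simplex with two equal components, and a simplex with
distinct components lies in `D^k(f)`, because its interior consists of strict multiple points
(`IsAlternating.exists_chainMap_DIncl_eq`, `mem_D_of_injective_WComponent`). So the rows of the
second double complex are exact too.

For a first quadrant double complex with exact rows, a cycle of the total complex without component
on the `p`-axis bounds within the columns it occupies (`DoubleComplex.RowsExact.exists_totD_eq`).
The statements on `E^2` and on the homology of the total complex follow from this.
-/

namespace ICSS

universe u v

/-! ### Double complexes with exact rows -/

namespace DoubleComplex

variable (K : DoubleComplex.{u})

theorem totHor_apply (i j p q : ℕ) (c : K.C i j) :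
    K.totHor i j c (p, q)
      = K.d' p q (DirectSum.lof ℤ (ℕ × ℕ) (fun pq => K.C pq.1 pq.2) (i, j) c (p + 1, q)) := by
  cases i with
  | zero =>
    rw [DirectSum.lof_eq_of, DirectSum.of_eq_of_ne _ _ _ (by simp), map_zero]
    rfl
  | succ i =>
    by_cases h : (i, j) = (p, q)
    · obtain ⟨rfl, rfl⟩ := Prod.mk.inj h
      simp only [totHor, LinearMap.comp_apply, DirectSum.lof_apply]
    · have h' : (p, q) ≠ (i, j) := fun e => h e.symm
      have h'' : (p + 1, q) ≠ (i + 1, j) := fun e => h' (by simpa using e)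
      simp only [totHor, LinearMap.comp_apply, DirectSum.lof_eq_of]
      rw [DirectSum.of_eq_of_ne _ _ _ h', DirectSum.of_eq_of_ne _ _ _ h'', map_zero]

theorem totVert_apply (i j p q : ℕ) (c : K.C i j) :
    K.totVert i j c (p, q)
      = K.d'' p q (DirectSum.lof ℤ (ℕ × ℕ) (fun pq => K.C pq.1 pq.2) (i, j) c (p, q + 1)) := by
  cases j with
  | zero =>
    rw [DirectSum.lof_eq_of, DirectSum.of_eq_of_ne _ _ _ (by simp), map_zero]
    cases i <;> rfl
  | succ j =>
    have e : K.totVert i (j + 1)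
        = (DirectSum.lof ℤ (ℕ × ℕ) (fun pq => K.C pq.1 pq.2) (i, j)).comp (K.d'' i j) := by
      cases i <;> rfl
    rw [e]
    by_cases h : (i, j) = (p, q)
    · obtain ⟨rfl, rfl⟩ := Prod.mk.inj h
      simp only [LinearMap.comp_apply, DirectSum.lof_apply]
    · have h' : (p, q) ≠ (i, j) := fun e => h e.symm
      have h'' : (p, q + 1) ≠ (i, j + 1) := fun e => h' (by simpa using e)
      simp only [LinearMap.comp_apply, DirectSum.lof_eq_of]
      rw [DirectSum.of_eq_of_ne _ _ _ h', DirectSum.of_eq_of_ne _ _ _ h'', map_zero]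

theorem totD_apply (x : K.Tot) (p q : ℕ) :
    K.totD x (p, q) = K.d' p q (x (p + 1, q)) + K.d'' p q (x (p, q + 1)) := by
  have h : (DirectSum.component ℤ (ℕ × ℕ) (fun pq => K.C pq.1 pq.2) (p, q)).comp K.totD
      = (K.d' p q).comp (DirectSum.component ℤ (ℕ × ℕ) (fun pq => K.C pq.1 pq.2) (p + 1, q))
        + (K.d'' p q).comp
          (DirectSum.component ℤ (ℕ × ℕ) (fun pq => K.C pq.1 pq.2) (p, q + 1)) := by
    refine DirectSum.linearMap_ext ℤ fun ij => LinearMap.ext fun c => ?_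
    obtain ⟨i, j⟩ := ij
    change K.totD (DirectSum.lof ℤ (ℕ × ℕ) (fun pq => K.C pq.1 pq.2) (i, j) c) (p, q) = _
    rw [totD, DirectSum.toModule_lof, LinearMap.add_apply, DirectSum.add_apply, totHor_apply,
      totVert_apply]
    rfl
  exact LinearMap.congr_fun h x

theorem totD_totD (x : K.Tot) : K.totD (K.totD x) = 0 := by
  refine DFinsupp.ext fun ⟨p, q⟩ => ?_
  change K.totD (K.totD x) (p, q) = 0
  rw [totD_apply, totD_apply, totD_apply, map_add, map_add, K.d'_d', K.d''_d'', zero_add, add_zero,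
    K.anticomm]

variable {K}

theorem totD_mem_totDeg {x : K.Tot} {m : ℤ} (hx : x ∈ K.totDeg m) :
    K.totD x ∈ K.totDeg (m - 1) := by
  rintro ⟨p, q⟩ h
  rw [totD_apply, hx (p + 1, q) (by push_cast; push_cast at h; lia),
    hx (p, q + 1) (by push_cast; push_cast at h; lia), map_zero, map_zero, add_zero]

theorem totD_mem_filtI {x : K.Tot} {p : ℤ} (hx : x ∈ K.filtI p) : K.totD x ∈ K.filtI p := by
  rintro ⟨i, j⟩ h
  rw [totD_apply, hx (i + 1, j) (by push_cast; push_cast at h; lia), hx (i, j + 1) h, map_zero,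
    map_zero, add_zero]

theorem filtI_mono {p p' : ℤ} (h : p ≤ p') : K.filtI p ≤ K.filtI p' :=
  fun _ hx ij hij => hx ij (h.trans_lt hij)

theorem totDeg_le_filtI (m : ℤ) : K.totDeg m ≤ K.filtI m :=
  fun _ hx ij hij => hx ij (by lia)

/-- The element of the total module with the single component `c`. -/
noncomputable def single (K : DoubleComplex.{u}) (p q : ℕ) (c : K.C p q) : K.Tot :=
  DirectSum.lof ℤ (ℕ × ℕ) (fun pq => K.C pq.1 pq.2) (p, q) c

theorem single_same (p q : ℕ) (c : K.C p q) : K.single p q c (p, q) = c :=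
  DirectSum.lof_apply ℤ (ι := ℕ × ℕ) (M := fun pq => K.C pq.1 pq.2) (p, q) c

theorem single_of_ne {p q : ℕ} (c : K.C p q) {ij : ℕ × ℕ} (h : ij ≠ (p, q)) :
    K.single p q c ij = 0 :=
  DirectSum.of_eq_of_ne _ _ _ h

theorem single_mem_totDeg {p q : ℕ} (c : K.C p q) {m : ℤ} (hm : (p : ℤ) + q = m) :
    K.single p q c ∈ K.totDeg m := by
  intro ij h
  refine single_of_ne c ?_
  rintro rfl
  exact h hm

theorem single_mem_filtI {p q : ℕ} (c : K.C p q) : K.single p q c ∈ K.filtI p := by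
  intro ij h
  refine single_of_ne c ?_
  rintro rfl
  exact lt_irrefl _ h

/-- If `x` lies in the filtration step `p` and `x` agrees with `y` in the one bidegree of column
`p`, then the difference drops to the step `p - 1`. -/
theorem sub_mem_filtI {p q : ℕ} {m : ℤ} {x y : K.Tot} (hm : (p : ℤ) + q = m)
    (hx : x ∈ K.totDeg m) (hy : y ∈ K.totDeg m) (hx' : x ∈ K.filtI p) (hy' : y ∈ K.filtI p)
    (h : x (p, q) = y (p, q)) : x - y ∈ K.filtI (p - 1) := by
  rintro ⟨i, j⟩ hij
  by_cases h1 : (i, j) = (p, q)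
  · obtain ⟨rfl, rfl⟩ := Prod.mk.inj h1
    rw [DirectSum.sub_apply, h, sub_self]
  by_cases h2 : (i : ℤ) + j = m
  · have h3 : (p : ℤ) < i := by
      simp only [Prod.mk.injEq] at h1
      push_cast at hij
      lia
    exact (K.filtI p).sub_mem hx' hy' (i, j) h3
  · exact (K.totDeg m).sub_mem hx hy (i, j) h2

/-- The rows of `K` (the complexes `C p •`) are exact in positive degrees. -/
def RowsExact (K : DoubleComplex.{u}) : Prop :=
  ∀ p q x, K.d'' p q x = 0 → ∃ y, K.d'' p (q + 1) y = x

/-- A primitive under `d''` of the component of `z` in column `p` removes that component: `z` is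
congruent, modulo boundaries, to an element of the next smaller filtration step. -/
theorem sub_totD_single_mem {p q : ℕ} {m : ℤ} (hm : (p : ℤ) + q = m) {z : K.Tot}
    (hz : z ∈ K.totDeg m) (hzp : z ∈ K.filtI p) (y : K.C p (q + 1))
    (hy : K.d'' p q y = z (p, q)) :
    K.single p (q + 1) y ∈ K.totDeg (m + 1) ⊓ K.filtI p ∧
      z - K.totD (K.single p (q + 1) y) ∈ K.totDeg m ⊓ K.filtI (p - 1) := by
  have hs : K.single p (q + 1) y ∈ K.totDeg (m + 1) := single_mem_totDeg y (by push_cast; lia)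
  have hs' := single_mem_filtI (K := K) (q := q + 1) y
  have hDs := totD_mem_totDeg hs
  rw [add_sub_cancel_right] at hDs
  refine ⟨⟨hs, hs'⟩, Submodule.sub_mem _ hz hDs,
    sub_mem_filtI hm hz hDs hzp (totD_mem_filtI hs') ?_⟩
  rw [totD_apply, single_of_ne y (by simp), map_zero, zero_add, single_same, hy]

/-- A cycle of the total complex without component on the `p`-axis is a boundary, and the bounding
chain needs no further columns: the components are removed column by column. -/
theorem RowsExact.exists_totD_eq (hK : K.RowsExact) {m p : ℤ} (hpm : p < m) {z : K.Tot}
    (hz : z ∈ K.totDeg m) (hzp : z ∈ K.filtI p) (hD : K.totD z = 0) :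
    ∃ w ∈ K.totDeg (m + 1) ⊓ K.filtI p, K.totD w = z := by
  obtain ⟨N, hN⟩ : ∃ N : ℕ, p < N := ⟨(p + 1).toNat, by lia⟩
  induction N generalizing z p with
  | zero =>
    refine ⟨0, Submodule.zero_mem _, ?_⟩
    rw [map_zero]
    exact (DFinsupp.ext fun ij => hzp ij (by push_cast at hN; lia)).symm
  | succ N ih =>
    rcases lt_or_ge p N with hp | hp
    · exact ih hpm hz hzp hD hp
    obtain rfl : p = N := by push_cast at hN; lia
    obtain ⟨q, rfl⟩ : ∃ q : ℕ, m = N + q + 1 := ⟨(m - N - 1).toNat, by lia⟩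
    have h0 := totD_apply K z N q
    rw [hD, hzp (N + 1, q) (by push_cast; lia), map_zero, zero_add] at h0
    obtain ⟨y, hy⟩ := hK N q _ h0.symm
    obtain ⟨hs, h1⟩ := sub_totD_single_mem (q := q + 1) (by push_cast; lia) hz hzp y hy
    obtain ⟨w, hw, hw'⟩ := ih (by lia) h1.1 h1.2 (by rw [map_sub, hD, totD_totD, sub_zero])
      (by lia)
    refine ⟨w + K.single N (q + 2) y, ⟨Submodule.add_mem _ hw.1 hs.1,
      Submodule.add_mem _ (filtI_mono (by lia) hw.2) hs.2⟩, ?_⟩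
    rw [map_add, hw', sub_add_cancel]

/-- For `q > 0` and `x` in `Z^2_{p,q}`, the boundary of `x` is bounded by some `w` in column `p - 2`
or less, and then the cycle `x - w` is a boundary. -/
theorem RowsExact.firstSSCollapsesOntoPAxis (hK : K.RowsExact) :
    K.FirstSSCollapsesOntoPAxis := by
  intro p q hq
  rw [Submodule.Quotient.subsingleton_iff, Submodule.submoduleOf_eq_top]
  rintro x ⟨⟨hx1, hx2⟩, hx3⟩
  rw [SetLike.mem_coe, Submodule.mem_comap] at hx3
  rcases hq.lt_or_gt with hq | hq
  -- For `q < 0` there is no component in column `p`.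
  · refine Submodule.mem_sup_left ⟨⟨by simpa using hx1, ?_⟩, ?_⟩
    · exact filtI_mono (by lia) (totDeg_le_filtI _ hx1)
    · rw [SetLike.mem_coe, Submodule.mem_comap]
      exact filtI_mono (by lia) hx3
  · obtain ⟨w, hw, hw'⟩ := hK.exists_totD_eq (by lia) (totD_mem_totDeg hx1) hx3 (totD_totD K x)
    rw [sub_add_cancel] at hw
    have hxw : x - w ∈ K.filtI p := Submodule.sub_mem _ hx2 (filtI_mono (by lia) hw.2)
    obtain ⟨v, hv, hv'⟩ := hK.exists_totD_eq (p := p) (by lia) (Submodule.sub_mem _ hx1 hw.1)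
      hxw (by rw [map_sub, hw', sub_self])
    refine Submodule.mem_sup.2 ⟨w, ⟨⟨by simpa using hw.1, filtI_mono (by lia) hw.2⟩, ?_⟩, x - w,
      ⟨v, ⟨⟨?_, filtI_mono (by lia) hv.2⟩, ?_⟩, hv'⟩, by abel⟩
    · rw [SetLike.mem_coe, Submodule.mem_comap, hw']
      exact filtI_mono (by lia) hx3
    · have e : p + 2 - 1 + (q - 2 + 2) = p + q + 1 := by ring
      rw [e]
      exact hv.1
    · rw [SetLike.mem_coe, Submodule.mem_comap, hv']
      exact filtI_mono (by lia) hxw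

/-- Two subquotients agree if the inclusion of the smaller numerator is onto modulo the larger
denominator and injective modulo the smaller one. -/
theorem nonempty_subquotient_equiv {M : Type u} [AddCommGroup M] {Z Z' B B' : Submodule ℤ M}
    (h1 : Z ≤ Z') (h2 : Z' ≤ Z ⊔ B') (h4 : ∀ x ∈ Z, x ∈ B' ↔ x ∈ B) :
    Nonempty ((Z' ⧸ B'.submoduleOf Z') ≃ₗ[ℤ] (Z ⧸ B.submoduleOf Z)) := by
  let g : Z →ₗ[ℤ] (Z' ⧸ B'.submoduleOf Z') :=
    (B'.submoduleOf Z').mkQ.comp (Submodule.inclusion h1)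
  have hg : Function.Surjective g := by
    intro y
    obtain ⟨⟨x, hx⟩, rfl⟩ := Submodule.mkQ_surjective _ y
    obtain ⟨z, hz, b, hb, rfl⟩ := Submodule.mem_sup.1 (h2 hx)
    refine ⟨⟨z, hz⟩, ?_⟩
    refine (Submodule.Quotient.eq _).2 ?_
    change z - (z + b) ∈ B'
    rw [sub_add_cancel_left]
    exact B'.neg_mem hb
  have hk : LinearMap.ker g = B.submoduleOf Z := by
    ext ⟨x, hx⟩
    change g ⟨x, hx⟩ = 0 ↔ x ∈ B
    rw [← h4 x hx]
    exact Submodule.Quotient.mk_eq_zero _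
  exact ⟨((Submodule.quotEquivOfEq _ _ hk.symm).trans (g.quotKerEquivOfSurjective hg)).symm⟩

/-- On the `p`-axis the term `E^2_{n,0}` is already the homology of the total complex. -/
theorem RowsExact.nonempty_firstSS_equiv (hK : K.RowsExact) (n : ℕ) :
    Nonempty (K.firstSS 2 n 0 ≃ₗ[ℤ] K.totHomology n) := by
  have e1 : (n : ℤ) + 2 - 1 + (0 - 2 + 2) = n + 1 := by ring
  have hb : ∀ {v : K.Tot}, v ∈ K.totDeg (n + 1) → v ∈ K.ssCycles (2 - 1) (n + 2 - 1) (0 - 2 + 2) := by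
    intro v hv
    have hD := totDeg_le_filtI _ (totD_mem_totDeg hv)
    refine ⟨⟨by rwa [e1], filtI_mono (by lia) (totDeg_le_filtI _ hv)⟩, ?_⟩
    rw [SetLike.mem_coe, Submodule.mem_comap]
    exact filtI_mono (by lia) hD
  refine nonempty_subquotient_equiv ?_ ?_ ?_
  · rintro x ⟨hx, hx'⟩
    refine ⟨⟨by simpa using hx, totDeg_le_filtI _ hx⟩, ?_⟩
    rw [SetLike.mem_coe, Submodule.mem_comap, LinearMap.mem_ker.1 hx']
    exact Submodule.zero_mem _
  · rintro x ⟨⟨hx1, hx2⟩, hx3⟩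
    rw [add_zero] at hx1
    rw [SetLike.mem_coe, Submodule.mem_comap] at hx3
    obtain ⟨w, hw, hw'⟩ := hK.exists_totD_eq (by lia) (totD_mem_totDeg hx1) hx3 (totD_totD K x)
    rw [sub_add_cancel] at hw
    refine Submodule.mem_sup.2 ⟨x - w, ⟨Submodule.sub_mem _ hx1 hw.1, ?_⟩, w,
      Submodule.mem_sup_left ⟨⟨by simpa using hw.1, filtI_mono (by lia) hw.2⟩, ?_⟩,
      sub_add_cancel x w⟩
    · rw [SetLike.mem_coe, LinearMap.mem_ker, map_sub, hw', sub_self]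
    · rw [SetLike.mem_coe, Submodule.mem_comap, hw']
      exact filtI_mono (by lia) hx3
  · rintro x ⟨hx, hx'⟩
    rw [SetLike.mem_coe, LinearMap.mem_ker] at hx'
    constructor
    · intro h
      obtain ⟨u, ⟨⟨hu1, hu2⟩, hu3⟩, _, ⟨v, ⟨⟨hv1, hv2⟩, hv3⟩, rfl⟩, rfl⟩ := Submodule.mem_sup.1 h
      rw [e1] at hv1
      rw [map_add, totD_totD, add_zero] at hx'
      obtain ⟨w, hw, rfl⟩ := hK.exists_totD_eq (by lia) hu1 hu2 hx'
      refine ⟨w + v, Submodule.add_mem _ (by simpa using hw.1) hv1, map_add _ _ _⟩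
    · rintro ⟨v, hv, rfl⟩
      exact Submodule.mem_sup_right ⟨v, hb hv, rfl⟩

/-- A double complex with exact rows whose `p`-axis is augmented onto a complex `B`, with the
image of `d''` as kernel, has the homology of `B` as total homology. -/
theorem RowsExact.nonempty_totHomology_equiv (hK : K.RowsExact) {B : ℕ → Type v}
    [∀ n, AddCommGroup (B n)] (d : ∀ n, B (n + 1) →ₗ[ℤ] B n) (Z : ∀ n, Submodule ℤ (B n))
    (hZ0 : Z 0 = ⊤) (hZ : ∀ n, Z (n + 1) = LinearMap.ker (d n))
    (a : ∀ n, K.C n 0 →ₗ[ℤ] B n) (hsurj : ∀ n, Function.Surjective (a n))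
    (hcomm : ∀ n x, a n (K.d' n 0 x) = d n (a (n + 1) x))
    (hzero : ∀ n x, a n (K.d'' n 0 x) = 0)
    (hex : ∀ n x, a n x = 0 → ∃ y, K.d'' n 0 y = x) (n : ℕ) :
    Nonempty (K.totHomology n ≃ₗ[ℤ] (Z n ⧸ (LinearMap.range (d n)).submoduleOf (Z n))) := by
  -- A total cycle with augmentation zero bounds within its own columns.
  have key : ∀ (m : ℕ) (z : K.Tot), z ∈ K.totDeg m → K.totD z = 0 → a m (z (m, 0)) = 0 →
      ∃ w ∈ K.totDeg (m + 1) ⊓ K.filtI m, K.totD w = z := by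
    intro m z hz hD h
    obtain ⟨y, hy⟩ := hex m _ h
    obtain ⟨hs, h1⟩ := sub_totD_single_mem (q := 0) (by simp) hz (totDeg_le_filtI _ hz) y hy
    obtain ⟨w, hw, hw'⟩ := hK.exists_totD_eq (by lia) h1.1 h1.2
      (by rw [map_sub, hD, totD_totD, sub_zero])
    refine ⟨w + K.single m 1 y, ⟨Submodule.add_mem _ hw.1 hs.1,
      Submodule.add_mem _ (filtI_mono (by lia) hw.2) hs.2⟩, ?_⟩
    rw [map_add, hw', sub_add_cancel]
  have hcyc : ∀ x : K.Tot, K.totD x = 0 → a n (x (n, 0)) ∈ Z n := by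
    intro x hx
    cases n with
    | zero => rw [hZ0]; trivial
    | succ n =>
      have h := congrArg (a n) (totD_apply K x n 0)
      rw [hx, map_add, hzero, add_zero, hcomm] at h
      rw [hZ, LinearMap.mem_ker, ← h]
      exact map_zero _
  let φ : K.totCycles n →ₗ[ℤ] Z n :=
    ((a n).comp (DirectSum.component ℤ (ℕ × ℕ) (fun pq => K.C pq.1 pq.2) (n, 0))).restrict
      fun x hx => hcyc x hx.2
  have hφ : ∀ x, (φ x : B n) = a n (x.1 (n, 0)) := fun _ => rfl
  have hφs : Function.Surjective φ := by
    rintro ⟨b, hb⟩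
    obtain ⟨x, rfl⟩ := hsurj n b
    have hs : K.single n 0 x ∈ K.totDeg n := single_mem_totDeg x (by simp)
    -- Correct `x` to a total cycle by a chain without component on the `p`-axis.
    obtain ⟨w, hw, hwn, hw'⟩ : ∃ w ∈ K.totDeg n, w (n, 0) = 0 ∧
        K.totD w = K.totD (K.single n 0 x) := by
      cases n with
      | zero =>
        refine ⟨0, Submodule.zero_mem _, rfl, ?_⟩
        rw [map_zero]
        refine (DFinsupp.ext fun ij => totD_mem_totDeg hs ij ?_).symm
        push_cast
        lia
      | succ n =>
        have hD := totD_mem_totDeg hs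
        push_cast at hD
        rw [add_sub_cancel_right] at hD
        obtain ⟨w, hw, hw'⟩ := key n _ hD (totD_totD K _) (by
          rw [totD_apply, map_add, hzero, add_zero, hcomm, single_same]
          rw [hZ] at hb
          exact hb)
        exact ⟨w, by simpa using hw.1, hw.2 _ (by push_cast; lia), hw'⟩
    refine ⟨⟨K.single n 0 x - w, Submodule.sub_mem _ hs hw, ?_⟩, Subtype.ext ?_⟩
    · rw [SetLike.mem_coe, LinearMap.mem_ker, map_sub, hw', sub_self]
    · rw [hφ]
      change a n ((K.single n 0 x - w) (n, 0)) = a n x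
      rw [DirectSum.sub_apply, hwn, sub_zero, single_same]
  let g := ((LinearMap.range (d n)).submoduleOf (Z n)).mkQ.comp φ
  have hg : Function.Surjective g := (Submodule.mkQ_surjective _).comp hφs
  have hk : LinearMap.ker g = (K.totBoundaries n).submoduleOf (K.totCycles n) := by
    ext ⟨x, hx⟩
    have hgx : g ⟨x, hx⟩ = 0 ↔ a n (x (n, 0)) ∈ LinearMap.range (d n) :=
      Submodule.Quotient.mk_eq_zero _
    change g ⟨x, hx⟩ = 0 ↔ x ∈ K.totBoundaries n
    rw [hgx]
    constructor
    · rintro ⟨b, hb⟩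
      obtain ⟨y, rfl⟩ := hsurj (n + 1) b
      have hs : K.single (n + 1) 0 y ∈ K.totDeg (n + 1) := single_mem_totDeg y (by simp)
      have hDs := totD_mem_totDeg hs
      rw [add_sub_cancel_right] at hDs
      obtain ⟨w, hw, hw'⟩ := key n (x - K.totD (K.single (n + 1) 0 y))
        (Submodule.sub_mem _ hx.1 hDs) (by rw [map_sub, hx.2, totD_totD, sub_zero]) (by
          rw [DirectSum.sub_apply, totD_apply, map_sub, map_add, hzero, hcomm, single_same, hb,
            add_zero, sub_self])
      exact ⟨w + K.single (n + 1) 0 y, Submodule.add_mem _ hw.1 hs, by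
        rw [map_add, hw', sub_add_cancel]⟩
    · rintro ⟨w, hw, rfl⟩
      rw [totD_apply, map_add, hzero, hcomm, add_zero]
      exact ⟨_, rfl⟩
  exact ⟨(Submodule.quotEquivOfEq _ _ hk.symm).trans (g.quotKerEquivOfSurjective hg)⟩

end DoubleComplex

/-! ### Simplicial maps with finite fibres -/

section Geometry

variable {E : Type u} {F : Type v} [NormedAddCommGroup E] [NormedSpace ℝ E]
  [NormedAddCommGroup F] [NormedSpace ℝ F]
  {X : Geometry.SimplicialComplex ℝ E} {Y : Geometry.SimplicialComplex ℝ F} {f : E → F}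

/-- Barycentric coordinates with respect to a simplex are unique. -/
theorem weights_eq_of_sum_eq {s : Finset E} (hs : s ∈ X.faces) {w w' : E → ℝ}
    (h1 : ∑ a ∈ s, w a = ∑ a ∈ s, w' a) (h2 : ∑ a ∈ s, w a • a = ∑ a ∈ s, w' a • a) :
    ∀ a ∈ s, w a = w' a := by
  intro a ha
  have h := affineIndependent_iff.1 (X.indep hs) Finset.univ (fun b => w b - w' b)
    (by rw [Finset.sum_coe_sort s (fun b => w b - w' b), Finset.sum_sub_distrib, h1, sub_self])
    (by
      rw [Finset.sum_coe_sort s (fun b => (w b - w' b) • b)]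
      simp only [sub_smul]
      rw [Finset.sum_sub_distrib, h2, sub_self])
    ⟨a, ha⟩ (Finset.mem_univ _)
  exact sub_eq_zero.1 h

/-- A simplex which contains an interior point of `s` has `s` as a face. -/
theorem subset_of_sum_mem_convexHull {s t : Finset E} (hs : s ∈ X.faces) (ht : t ∈ X.faces)
    {w : E → ℝ} (hw : ∀ a ∈ s, 0 < w a) (hw1 : ∑ a ∈ s, w a = 1)
    (h : ∑ a ∈ s, w a • a ∈ convexHull ℝ (t : Set E)) : s ⊆ t := by
  classical
  have hm : ∑ a ∈ s, w a • a ∈ convexHull ℝ ((s ∩ t : Finset E) : Set E) := by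
    rw [Finset.coe_inter]
    exact X.inter_subset_convexHull hs ht
      ⟨Finset.mem_convexHull'.2 ⟨w, fun a ha => (hw a ha).le, hw1, rfl⟩, h⟩
  obtain ⟨v, hv, hv1, hv2⟩ := Finset.mem_convexHull'.1 hm
  intro a ha
  by_contra hat
  have h3 := weights_eq_of_sum_eq hs (w := w) (w' := fun a => if a ∈ t then v a else 0)
    (by rw [hw1, ← hv1, ← Finset.sum_filter, Finset.filter_mem_eq_inter])
    (by
      rw [← hv2]
      simp only [ite_smul, zero_smul]
      rw [← Finset.sum_filter, Finset.filter_mem_eq_inter])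
    a ha
  rw [if_neg hat] at h3
  exact (hw a ha).ne' h3

/-- A simplicial map with finite fibres is injective on the vertices of each simplex: otherwise it
is constant on an edge. -/
theorem IsSimplicialMap.injOn (hf : IsSimplicialMap X Y f)
    (hfin : ∀ y ∈ Y.space, (X.space ∩ f ⁻¹' {y}).Finite) {s : Finset E} (hs : s ∈ X.faces) :
    Set.InjOn f s := by
  classical
  intro a ha b hb hab
  by_contra hne
  have he : ({a, b} : Finset E) ∈ X.faces :=
    X.down_closed hs (by simp [Finset.insert_subset_iff, Finset.mem_coe.1 ha, Finset.mem_coe.1 hb])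
      (by simp)
  have hY : f a ∈ Y.space := by
    obtain ⟨t, ht, ht'⟩ := hf.image_mem s hs
    exact Y.subset_space ht (ht' ▸ Set.mem_image_of_mem f ha)
  -- The edge from `a` to `b` lies in the fibre over `f a`.
  refine (Set.Icc_infinite (zero_lt_one' ℝ)).mono (s := Set.Icc (0 : ℝ) 1)
    (t := AffineMap.lineMap a b ⁻¹' (X.space ∩ f ⁻¹' {f a})) ?_
    ((hfin _ hY).preimage (AffineMap.lineMap_injective ℝ hne).injOn)
  intro r hr
  have e : AffineMap.lineMap a b r
      = ∑ x ∈ ({a, b} : Finset E), (if x = a then 1 - r else r) • x := by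
    rw [Finset.sum_pair hne, AffineMap.lineMap_apply_module]
    simp [Ne.symm hne]
  have hw0 : ∀ x ∈ ({a, b} : Finset E), 0 ≤ (if x = a then 1 - r else r) := by
    intro x _
    split_ifs
    · linarith [hr.2]
    · exact hr.1
  have hw1 : ∑ x ∈ ({a, b} : Finset E), (if x = a then 1 - r else r) = 1 := by
    rw [Finset.sum_pair hne]
    simp [Ne.symm hne]
  refine ⟨?_, ?_⟩
  · rw [e]
    exact X.convexHull_subset_space he (Finset.mem_convexHull'.2 ⟨_, hw0, hw1, rfl⟩)
  · rw [Set.mem_preimage, Set.mem_singleton_iff, e, hf.affine _ he _ hw0 hw1, Finset.sum_pair hne,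
      ← hab, ← add_smul]
    simp [Ne.symm hne]

/-- Every simplex of the target of a surjective simplicial map is the image of a
simplex: take a simplex through a preimage of the barycentre. -/
theorem IsSimplicialMap.exists_face (hf : IsSimplicialMap X Y f)
    (hsurj : Set.SurjOn f X.space Y.space) {t : Finset F} (ht : t ∈ Y.faces) :
    ∃ s ∈ X.faces, f '' s = t := by
  classical
  have h0 := Y.nonempty_of_mem_faces ht
  have hc : (0 : ℝ) < (t.card : ℝ)⁻¹ := by
    rw [inv_pos]
    exact_mod_cast h0.card_pos
  have hw1 : ∑ _b ∈ t, (t.card : ℝ)⁻¹ = 1 := by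
    rw [Finset.sum_const, nsmul_eq_mul, mul_inv_cancel₀]
    exact_mod_cast h0.card_pos.ne'
  have hb : ∑ b ∈ t, (t.card : ℝ)⁻¹ • b ∈ Y.space :=
    Y.convexHull_subset_space ht (Finset.mem_convexHull'.2 ⟨fun _ => _, fun _ _ => hc.le, hw1, rfl⟩)
  obtain ⟨x, hx, hxb⟩ := hsurj hb
  obtain ⟨s, hs, hxs⟩ := Geometry.SimplicialComplex.mem_space_iff.1 hx
  obtain ⟨w, hw, hws, rfl⟩ := Finset.mem_convexHull'.1 hxs
  rw [hf.affine s hs w hw hws] at hxb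
  obtain ⟨t', ht', hst⟩ := hf.image_mem s hs
  have htt : t ⊆ t' := by
    refine subset_of_sum_mem_convexHull ht ht' (fun _ _ => hc) hw1 ?_
    rw [← hxb, hst]
    exact (convex_convexHull ℝ _).sum_mem hw hws
      fun a ha => subset_convexHull ℝ _ (Set.mem_image_of_mem f ha)
  have him : f '' ((s.filter fun a => f a ∈ t : Finset E) : Set E) = t := by
    ext b
    constructor
    · rintro ⟨a, ha, rfl⟩
      exact (Finset.mem_filter.1 ha).2
    · intro hb
      obtain ⟨a, ha, rfl⟩ := (hst ▸ htt hb : b ∈ f '' s)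
      exact ⟨a, by simpa using ⟨ha, hb⟩, rfl⟩
  refine ⟨s.filter fun a => f a ∈ t, X.down_closed hs (Finset.filter_subset _ _) ?_, him⟩
  rw [← Finset.coe_nonempty, ← Set.image_nonempty (f := f), him]
  exact_mod_cast h0

/-- The vertex map of a simplicial map with finite fibres. -/
def IsSimplicialMap.nondegMap (hf : IsSimplicialMap X Y f)
    (hfin : ∀ y ∈ Y.space, (X.space ∩ f ⁻¹' {y}).Finite) :
    NondegMap X.toPreAbstractSimplicialComplex Y.toPreAbstractSimplicialComplex where
  toFun := f
  injOn := fun _ hs => hf.injOn hfin hs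
  image_mem := hf.image_mem

end Geometry

/-! ### Reordering of simplices -/

section OrderedSimplices

variable {V : Type u} {V' : Type v} {K : PreAbstractSimplicialComplex V}
  {K' : PreAbstractSimplicialComplex V'} {n : ℕ}

theorem OrderedSimplex.ext' {s t : OrderedSimplex K n} (h : ∀ i, s.1 i = t.1 i) : s = t :=
  Subtype.ext (DFunLike.ext _ _ h)

/-- A map with the property that each simplex lifts has a lift of ordered simplices that is
compatible with reordering. -/
theorem exists_perm_lift (g : NondegMap K K') (h : ∀ t ∈ K'.faces, ∃ s ∈ K.faces, g.toFun '' s = t)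
    (n : ℕ) : ∃ ℓ : OrderedSimplex K' n → OrderedSimplex K n,
      (∀ y i, g.toFun ((ℓ y).1 i) = y.1 i) ∧ ∀ y σ, ℓ (y.perm σ) = (ℓ y).perm σ := by
  choose S hS hS' using h
  have hy : ∀ (y : OrderedSimplex K' n) i, ∃ a ∈ S _ y.2, g.toFun a = y.1 i := fun y i => by
    have : y.1 i ∈ g.toFun '' (S _ y.2) := by rw [hS']; simp
    exact this
  choose a ha ha' using hy
  have hinj : ∀ y, Function.Injective (a y) := fun y i j hij =>
    y.1.injective (by rw [← ha', ← ha', hij])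
  refine ⟨fun y => ⟨⟨a y, hinj y⟩, ?_⟩, fun y i => ha' y i, fun y σ => ?_⟩
  · exact (K.isRelLowerSet_faces (hS _ y.2)).2
      (by intro x hx; obtain ⟨i, -, rfl⟩ := Finset.mem_map.1 hx; exact ha y i) (by simp)
  · refine OrderedSimplex.ext' fun i => g.injOn _ (hS _ y.2) ?_ (ha y (σ i)) ?_
    · have h1 := ha (y.perm σ) i
      simp only [map_univ_perm] at h1
      exact h1
    · exact (ha' (y.perm σ) i).trans (ha' y (σ i)).symm

/-- After a choice of representatives up to reordering, `τ s` is the permutation which reorders the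
representative of `s` to `s`. -/
theorem exists_perm_section (K : PreAbstractSimplicialComplex V) (n : ℕ) :
    ∃ τ : OrderedSimplex K n → Equiv.Perm (Fin (n + 1)), ∀ s σ, τ (s.perm σ) = τ s * σ := by
  let g : OrderedSimplex K n → Finset V := fun s => Finset.univ.map s.1
  let ref : OrderedSimplex K n → OrderedSimplex K n :=
    fun s => Set.rangeSplitting g ⟨g s, s, rfl⟩
  have href : ∀ s, g (ref s) = g s := fun s => Set.apply_rangeSplitting g ⟨g s, s, rfl⟩
  have href' : ∀ s (σ : Equiv.Perm (Fin (n + 1))), ref (s.perm σ) = ref s := fun s σ => by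
    have : g (s.perm σ) = g s := map_univ_perm s σ
    simp only [ref, this]
  choose τ hτ using fun s => exists_perm_eq s (ref s) (href s).symm
  refine ⟨τ, fun s σ => perm_injective (ref s) ?_⟩
  rw [← href' s σ, ← hτ (s.perm σ), href' s σ]
  conv_lhs => rw [hτ s]
  rfl

end OrderedSimplices

/-! ### Chains and sections of the passage to oriented chains -/

section Chains

variable {V : Type u} {V' : Type v} {K : PreAbstractSimplicialComplex V}
  {K' : PreAbstractSimplicialComplex V'}

/-- The class of an ordered simplex in the chain group. -/
noncomputable def basisChain (κ : ChainConvention) {n : ℕ} (s : OrderedSimplex K n) : Chain κ K n :=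
  (chainRel κ K n).mkQ (Finsupp.single s 1)

theorem chain_hom_ext (κ : ChainConvention) {n : ℕ} {M : Type*} [AddCommGroup M]
    {a b : Chain κ K n →ₗ[ℤ] M} (h : ∀ s, a (basisChain κ s) = b (basisChain κ s)) : a = b := by
  refine Submodule.linearMap_qext _ (Finsupp.lhom_ext' fun s => LinearMap.ext_ring ?_)
  exact h s

/-- The homomorphism of chain groups induced by a map of ordered simplices which commutes with
reordering. -/
noncomputable def permMap (κ : ChainConvention) {n : ℕ}
    (u : OrderedSimplex K n → OrderedSimplex K' n) (hu : ∀ s σ, u (s.perm σ) = (u s).perm σ) :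
    Chain κ K n →ₗ[ℤ] Chain κ K' n :=
  Submodule.mapQ _ _ (Finsupp.lmapDomain ℤ ℤ u) (by
    cases κ with
    | ordered => exact bot_le
    | oriented =>
      refine Submodule.span_le.2 ?_
      rintro _ ⟨s, σ, rfl⟩
      refine Submodule.subset_span ⟨u s, σ, ?_⟩
      rw [map_sub, map_smul]
      simp only [Finsupp.lmapDomain_apply, Finsupp.mapDomain_single, hu])

theorem permMap_basisChain (κ : ChainConvention) {n : ℕ}
    (u : OrderedSimplex K n → OrderedSimplex K' n) (hu : ∀ s σ, u (s.perm σ) = (u s).perm σ)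
    (s : OrderedSimplex K n) : permMap κ u hu (basisChain κ s) = basisChain κ (u s) := by
  simp [permMap, basisChain]

theorem chainMap_basisChain (κ : ChainConvention) (g : NondegMap K K') {n : ℕ}
    (s : OrderedSimplex K n) : chainMap κ g n (basisChain κ s) = basisChain κ (s.map g) := by
  simp [chainMap, basisChain, freeMap]

/-- The sections of `exists_free_section` on basis elements: `[s]` is represented by the reordering
of `s` by the inverse of the permutation which belongs to its image in `L`. -/
theorem exists_free_section_formula (κ : ChainConvention) {U : Type*}
    (L : PreAbstractSimplicialComplex U) (n : ℕ) :
    ∃ τ : OrderedSimplex L n → Equiv.Perm (Fin (n + 1)),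
      ∀ {V : Type u} {K : PreAbstractSimplicialComplex V} (g : NondegMap K L),
        ∃ φ : Chain κ K n →ₗ[ℤ] (OrderedSimplex K n →₀ ℤ),
          (∀ c, (chainRel κ K n).mkQ (φ c) = c) ∧
          ∀ s, φ (basisChain κ s) = (Equiv.Perm.sign (τ (s.map g)) : ℤ) •
            Finsupp.single (s.perm (τ (s.map g))⁻¹) 1 := by
  cases κ with
  | ordered =>
    refine ⟨fun _ => 1, fun {V K} g =>
      ⟨(Submodule.quotEquivOfEqBot (chainRel .ordered K n) rfl).toLinearMap, fun c => ?_,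
        fun s => ?_⟩⟩
    · exact (Submodule.quotEquivOfEqBot _ rfl).symm_apply_apply c
    · simp only [inv_one, Equiv.Perm.sign_one, Units.val_one, one_smul]
      exact Submodule.quotEquivOfEqBot_apply_mk _ rfl _
  | oriented =>
    obtain ⟨τ, hτ⟩ := exists_perm_section L n
    refine ⟨τ, fun {V K} g => ?_⟩
    let φ₀ : (OrderedSimplex K n →₀ ℤ) →ₗ[ℤ] (OrderedSimplex K n →₀ ℤ) :=
      Finsupp.linearCombination ℤ fun s => (Equiv.Perm.sign (τ (s.map g)) : ℤ) •
        Finsupp.single (s.perm (τ (s.map g))⁻¹) (1 : ℤ)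
    have hφ₀ : chainRel .oriented K n ≤ LinearMap.ker φ₀ := by
      refine Submodule.span_le.2 ?_
      rintro _ ⟨s, σ, rfl⟩
      have e : τ ((s.perm σ).map g) = τ (s.map g) * σ := hτ (s.map g) σ
      have e' : (s.perm σ).perm (τ (s.map g) * σ)⁻¹ = s.perm (τ (s.map g))⁻¹ :=
        OrderedSimplex.ext' fun i => congrArg s.1 (by simp)
      rw [SetLike.mem_coe, LinearMap.mem_ker, map_sub, map_smul]
      simp only [φ₀, Finsupp.linearCombination_single, e, e', smul_smul,
        Equiv.Perm.sign_mul, Units.val_mul]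
      rw [sub_eq_zero]
      congr 1
      ring
    have hφ : ∀ s, Submodule.liftQ _ φ₀ hφ₀ (basisChain .oriented s)
        = (Equiv.Perm.sign (τ (s.map g)) : ℤ) •
          Finsupp.single (s.perm (τ (s.map g))⁻¹) 1 := fun s => by
      simp [basisChain, φ₀]
    refine ⟨Submodule.liftQ _ φ₀ hφ₀, fun c => ?_, hφ⟩
    have h : (chainRel .oriented K n).mkQ.comp (Submodule.liftQ _ φ₀ hφ₀) = LinearMap.id := by
      refine chain_hom_ext _ fun s => ?_
      rw [LinearMap.comp_apply, hφ, LinearMap.id_apply, basisChain, ← sub_eq_zero, ← map_sub]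
      refine (Submodule.Quotient.mk_eq_zero _).2 ?_
      set σ := τ (s.map g)
      have h1 : Finsupp.single (s.perm σ⁻¹) 1
          - (Equiv.Perm.sign σ⁻¹ : ℤ) • Finsupp.single s 1 ∈ chainRel .oriented K n :=
        Submodule.subset_span ⟨s, σ⁻¹, rfl⟩
      have h2 := (chainRel .oriented K n).smul_mem (Equiv.Perm.sign σ : ℤ) h1
      rw [smul_sub, smul_smul, Equiv.Perm.sign_inv, ← Units.val_mul, Int.units_mul_self,
        Units.val_one, one_smul] at h2
      exact h2
    exact LinearMap.congr_fun h c

/-- Sections of the projections from free chains to chains, for all complexes over `L` at once. In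
the oriented convention they represent an oriented simplex by its reordering which maps to a chosen
representative of its image in `L`; this makes them natural for maps over `L`. -/
theorem exists_free_section (κ : ChainConvention) {U : Type*} (L : PreAbstractSimplicialComplex U)
    (n : ℕ) : ∃ φ : ∀ {V : Type u} {K : PreAbstractSimplicialComplex V} (_ : NondegMap K L),
        Chain κ K n →ₗ[ℤ] (OrderedSimplex K n →₀ ℤ),
      (∀ {V : Type u} {K : PreAbstractSimplicialComplex V} (g : NondegMap K L) c,
        (chainRel κ K n).mkQ (φ g c) = c) ∧
      ∀ {V V' : Type u} {K : PreAbstractSimplicialComplex V} {K' : PreAbstractSimplicialComplex V'}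
        (g : NondegMap K L) (g' : NondegMap K' L) (h : NondegMap K K'),
        (∀ s : OrderedSimplex K n, (s.map h).map g' = s.map g) →
        ∀ c, freeMap h n (φ g c) = φ g' (chainMap κ h n c) := by
  obtain ⟨τ, hτ⟩ := exists_free_section_formula.{u} κ L n
  choose φ hφ hφ' using @hτ
  refine ⟨fun {V K} g => φ g, fun {V K} g c => hφ g c, fun {V V' K K'} g g' h hh c => ?_⟩
  have e : (freeMap h n).comp (φ g) = (φ g').comp (chainMap κ h n) := by
    refine chain_hom_ext κ fun s => ?_
    rw [LinearMap.comp_apply, LinearMap.comp_apply, hφ', chainMap_basisChain, hφ', hh, map_smul]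
    congr 1
    exact Finsupp.mapDomain_single
  exact LinearMap.congr_fun e c

end Chains

/-! ### Simplices of the fibred products -/

section FibredProducts

variable {E : Type u} {F : Type v} [NormedAddCommGroup E] [NormedSpace ℝ E]
  {X : Geometry.SimplicialComplex ℝ E} {f : E → F}

/-- The ordered simplices of `X`. -/
abbrev XSimplex (X : Geometry.SimplicialComplex ℝ E) (n : ℕ) : Type u :=
  OrderedSimplex X.toPreAbstractSimplicialComplex n

theorem W_apply_eq {n k : ℕ} (s : OrderedSimplex (W X f k) n) (i : Fin (n + 1)) (l l' : Fin k) :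
    f (s.1 i l) = f (s.1 i l') :=
  s.2.2.2 _ (by simp) l l'

/-- The `l`-th component of an ordered simplex of `W^k(f)`. -/
def WComponent {n k : ℕ} (s : OrderedSimplex (W X f k) n) (l : Fin k) : XSimplex X n :=
  ⟨⟨fun i => s.1 i l, fun i j h =>
    s.1.injective ((s.2.2.1 l).1 (by simp) (by simp) h)⟩, by
    obtain ⟨t, ht, ht'⟩ := (s.2.2.1 l).2
    convert ht
    apply Finset.coe_injective
    rw [ht']
    ext x
    simp only [Finset.coe_map, Finset.coe_univ, Set.image_univ, Set.mem_range, Set.mem_image,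
      exists_exists_eq_and]
    rfl⟩

/-- The ordered simplex of `W^k(f)` with prescribed components over one ordered simplex of the
target. -/
def WSimplex {n q : ℕ} (a : Fin (q + 1) → XSimplex X n) (y : Fin (n + 1) → F)
    (h : ∀ l i, f ((a l).1 i) = y i) : OrderedSimplex (W X f (q + 1)) n :=
  ⟨⟨fun i l => (a l).1 i, fun _ _ hij => (a 0).1.injective (congrFun hij 0)⟩, by
    refine ⟨by simp, fun l => ⟨?_, Finset.univ.map (a l).1, (a l).2, ?_⟩, ?_⟩
    · intro x hx x' hx' hxx'
      obtain ⟨i, -, rfl⟩ := Finset.mem_map.1 hx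
      obtain ⟨i', -, rfl⟩ := Finset.mem_map.1 hx'
      rw [(a l).1.injective hxx']
    · ext x
      simp only [Finset.coe_map, Finset.coe_univ, Set.image_univ, Set.mem_range, Set.mem_image,
        exists_exists_eq_and]
      rfl
    · intro x hx l l'
      obtain ⟨i, -, rfl⟩ := Finset.mem_map.1 hx
      exact (h l i).trans (h l' i).symm⟩

theorem WSimplex_ext {n k : ℕ} {s t : OrderedSimplex (W X f k) n}
    (h : ∀ i l, s.1 i l = t.1 i l) : s = t :=
  OrderedSimplex.ext' fun i => funext (h i)

variable [NormedAddCommGroup F] [NormedSpace ℝ F] {Y : Geometry.SimplicialComplex ℝ F}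

/-- The projection of `W^k(f)` to the target of `f`. -/
def WBase (g : NondegMap X.toPreAbstractSimplicialComplex Y.toPreAbstractSimplicialComplex)
    (q : ℕ) : NondegMap (W X g.toFun (q + 1)) Y.toPreAbstractSimplicialComplex where
  toFun := fun x => g.toFun (x 0)
  injOn := by
    rintro t ⟨-, h1, -⟩
    obtain ⟨hi, s, hs, hs'⟩ := h1 0
    refine (g.injOn s hs).comp hi fun x hx => ?_
    rw [hs']
    exact Set.mem_image_of_mem _ hx
  image_mem := by
    rintro t ⟨-, h1, -⟩
    obtain ⟨-, s, hs, hs'⟩ := h1 0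
    obtain ⟨t', ht', h⟩ := g.image_mem s hs
    exact ⟨t', ht', by rw [h, hs', Set.image_image]⟩

/-- The action of the permutation `σ` on `W^k(f)`, `(x_1, …, x_k) ↦ (x_{σ 1}, …, x_{σ k})`. -/
def WPerm (X : Geometry.SimplicialComplex ℝ E) (f : E → F) (k : ℕ) (σ : Equiv.Perm (Fin k)) :
    NondegMap (W X f k) (W X f k) where
  toFun := fun x l => x (σ l)
  injOn := fun t _ x _ y _ hxy => by
    funext l
    simpa using congrFun hxy (σ.symm l)
  image_mem := W_reindex X f σ

variable {g : NondegMap X.toPreAbstractSimplicialComplex Y.toPreAbstractSimplicialComplex}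
  {n : ℕ} (ℓ : OrderedSimplex Y.toPreAbstractSimplicialComplex n → XSimplex X n)
  (hℓ : ∀ y i, g.toFun ((ℓ y).1 i) = y.1 i)

/-- All components of a simplex of `W^k(f)` have the same image, so the projections and permutations
are maps over `Y`. -/
theorem map_WProj_WBase {q : ℕ} (i : Fin (q + 2)) (s : OrderedSimplex (W X g.toFun (q + 2)) n) :
    (s.map (WProj X g.toFun q i)).map (WBase g q) = s.map (WBase g (q + 1)) :=
  OrderedSimplex.ext' fun _ => W_apply_eq s _ _ _

theorem map_WPerm_WBase {q : ℕ} (σ : Equiv.Perm (Fin (q + 1)))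
    (s : OrderedSimplex (W X g.toFun (q + 1)) n) :
    (s.map (WPerm X g.toFun (q + 1) σ)).map (WBase g q) = s.map (WBase g q) :=
  OrderedSimplex.ext' fun _ => W_apply_eq s _ _ _

/-- The lift `ℓ`, with values in `W^1(f) = X`. -/
def WLift (y : OrderedSimplex Y.toPreAbstractSimplicialComplex n) :
    OrderedSimplex (W X g.toFun 1) n :=
  WSimplex (fun _ => ℓ y) y.1 fun _ i => hℓ y i

/-- Insertion of the lift `ℓ` of the image of a simplex as a new `j`-th component. -/
def WInsert {q : ℕ} (j : Fin (q + 2)) (s : OrderedSimplex (W X g.toFun (q + 1)) n) :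
    OrderedSimplex (W X g.toFun (q + 2)) n :=
  WSimplex (j.insertNth (α := fun _ => XSimplex X n) (ℓ (s.map (WBase g q))) (WComponent s))
    (s.map (WBase g q)).1 (by
      refine (Fin.forall_iff_succAbove j).2 ⟨fun i => ?_, fun l i => ?_⟩
      · rw [Fin.insertNth_apply_same]
        exact hℓ _ i
      · rw [Fin.insertNth_apply_succAbove]
        exact W_apply_eq s i l 0)

theorem WInsert_apply_same {q : ℕ} (j : Fin (q + 2)) (s : OrderedSimplex (W X g.toFun (q + 1)) n)
    (i : Fin (n + 1)) : (WInsert ℓ hℓ j s).1 i j = (ℓ (s.map (WBase g q))).1 i := by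
  change (j.insertNth (α := fun _ => XSimplex X n) _ _ j).1 i = _
  rw [Fin.insertNth_apply_same]

theorem WInsert_apply_succAbove {q : ℕ} (j : Fin (q + 2))
    (s : OrderedSimplex (W X g.toFun (q + 1)) n) (i : Fin (n + 1)) (l : Fin (q + 1)) :
    (WInsert ℓ hℓ j s).1 i (j.succAbove l) = s.1 i l := by
  change (j.insertNth (α := fun _ => XSimplex X n) _ _ (j.succAbove l)).1 i = _
  rw [Fin.insertNth_apply_succAbove]
  rfl

/-- `WInsert` is characterized by its components. -/
theorem eq_WInsert {q : ℕ} (j : Fin (q + 2)) (s : OrderedSimplex (W X g.toFun (q + 1)) n)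
    {t : OrderedSimplex (W X g.toFun (q + 2)) n}
    (h1 : ∀ i, t.1 i j = (ℓ (s.map (WBase g q))).1 i)
    (h2 : ∀ i l, t.1 i (j.succAbove l) = s.1 i l) : t = WInsert ℓ hℓ j s := by
  refine WSimplex_ext fun i => (Fin.forall_iff_succAbove j).2 ⟨?_, fun l => ?_⟩
  · rw [WInsert_apply_same, h1]
  · rw [WInsert_apply_succAbove, h2]

theorem WInsert_map_WProj {q : ℕ} (j : Fin (q + 2)) (s : OrderedSimplex (W X g.toFun (q + 1)) n) :
    (WInsert ℓ hℓ j s).map (WProj X g.toFun q j) = s :=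
  WSimplex_ext fun i l => WInsert_apply_succAbove ℓ hℓ j s i l

theorem WInsert_zero_map_WProj_succ {q : ℕ} (i : Fin (q + 2))
    (s : OrderedSimplex (W X g.toFun (q + 2)) n) :
    (WInsert ℓ hℓ 0 s).map (WProj X g.toFun (q + 1) i.succ)
      = WInsert ℓ hℓ 0 (s.map (WProj X g.toFun q i)) := by
  refine eq_WInsert ℓ hℓ 0 _ (fun a => ?_) fun a l => ?_
  · rw [map_WProj_WBase, ← WInsert_apply_same ℓ hℓ 0]
    exact congrArg ((WInsert ℓ hℓ 0 s).1 a) (Fin.succ_succAbove_zero i)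
  · refine Eq.trans ?_ (WInsert_apply_succAbove ℓ hℓ 0 s a (i.succAbove l))
    refine congrArg ((WInsert ℓ hℓ 0 s).1 a) ?_
    rw [Fin.zero_succAbove, Fin.zero_succAbove, Fin.succ_succAbove_succ]

theorem WInsert_castSucc_map_WProj_last {q : ℕ} (j : Fin (q + 2))
    (s : OrderedSimplex (W X g.toFun (q + 2)) n) :
    (WInsert ℓ hℓ j.castSucc s).map (WProj X g.toFun (q + 1) (Fin.last (q + 2)))
      = WInsert ℓ hℓ j (s.map (WProj X g.toFun q (Fin.last (q + 1)))) := by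
  refine eq_WInsert ℓ hℓ j _ (fun a => ?_) fun a l => ?_
  · rw [map_WProj_WBase, ← WInsert_apply_same ℓ hℓ j.castSucc]
    exact congrArg ((WInsert ℓ hℓ j.castSucc s).1 a) (Fin.succAbove_last_apply j)
  · refine Eq.trans ?_ (WInsert_apply_succAbove ℓ hℓ j.castSucc s a
      ((Fin.last (q + 1)).succAbove l))
    refine congrArg ((WInsert ℓ hℓ j.castSucc s).1 a) ?_
    rw [Fin.succAbove_last_apply, Fin.succAbove_last_apply, Fin.castSucc_succAbove_castSucc]

theorem WInsert_zero_map_WProj_one (s : OrderedSimplex (W X g.toFun 1) n) :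
    (WInsert ℓ hℓ 0 s).map (WProj X g.toFun 0 1) = WLift ℓ hℓ (s.map (WBase g 0)) := by
  refine WSimplex_ext fun i l => ?_
  obtain rfl : l = 0 := Subsingleton.elim (α := Fin 1) _ _
  exact WInsert_apply_same ℓ hℓ 0 s i

/-- A permutation `σ` maps the complement of `i` to the complement of `σ i`; in terms of positions
this is a permutation with sign `(-1)^(σ i + i) sign σ`. -/
theorem exists_perm_succAbove {m : ℕ} (σ : Equiv.Perm (Fin (m + 1))) (i : Fin (m + 1)) :
    ∃ τ : Equiv.Perm (Fin m), (∀ l, σ (i.succAbove l) = (σ i).succAbove (τ l)) ∧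
      (-1) ^ (σ i : ℕ) * (Equiv.Perm.sign τ : ℤ) = (Equiv.Perm.sign σ : ℤ) * (-1) ^ (i : ℕ) := by
  set ρ : Equiv.Perm (Fin (m + 1)) := (σ i).cycleRange * σ * i.cycleRange⁻¹ with hρ
  have h0 : ρ 0 = 0 := by simp [hρ]
  obtain ⟨⟨p, τ⟩, hτ⟩ := Equiv.Perm.decomposeFin.symm.surjective ρ
  have hp : p = 0 := by
    rw [← hτ, Equiv.Perm.decomposeFin_symm_apply_zero] at h0
    exact h0
  subst hp
  refine ⟨τ, fun j => ?_, ?_⟩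
  · have h1 : ρ j.succ = (τ j).succ := by
      rw [← hτ, Equiv.Perm.decomposeFin_symm_apply_succ]; simp
    rw [← Fin.cycleRange_symm_succ (σ i) (τ j), ← h1, hρ]
    simp
  · have h4 : Equiv.Perm.sign ρ = Equiv.Perm.sign τ := by
      rw [← hτ, Equiv.Perm.decomposeFin.symm_sign]; simp
    rw [← h4, hρ]
    simp only [Equiv.Perm.sign_mul, Equiv.Perm.sign_inv, Fin.sign_cycleRange, Units.val_mul,
      Units.val_pow_eq_pow_val, Units.val_neg, Units.val_one]
    rw [← mul_assoc, ← mul_assoc, ← pow_add, Even.neg_one_pow ⟨_, rfl⟩, one_mul]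

theorem WInsert_map_WPerm {q : ℕ} (σ : Equiv.Perm (Fin (q + 2))) (τ : Equiv.Perm (Fin (q + 1)))
    (i : Fin (q + 2)) (h : ∀ l, σ (i.succAbove l) = (σ i).succAbove (τ l))
    (s : OrderedSimplex (W X g.toFun (q + 1)) n) :
    (WInsert ℓ hℓ (σ i) s).map (WPerm X g.toFun (q + 2) σ)
      = WInsert ℓ hℓ i (s.map (WPerm X g.toFun (q + 1) τ)) := by
  refine eq_WInsert ℓ hℓ i _ (fun a => ?_) fun a l => ?_
  · rw [map_WPerm_WBase]
    exact WInsert_apply_same ℓ hℓ (σ i) s a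
  · refine Eq.trans ?_ (WInsert_apply_succAbove ℓ hℓ (σ i) s a (τ l))
    exact congrArg ((WInsert ℓ hℓ (σ i) s).1 a) (h l)

theorem WInsert_perm (hℓ' : ∀ y σ, ℓ (y.perm σ) = (ℓ y).perm σ) {q : ℕ} (j : Fin (q + 2))
    (s : OrderedSimplex (W X g.toFun (q + 1)) n) (σ : Equiv.Perm (Fin (n + 1))) :
    WInsert ℓ hℓ j (s.perm σ) = (WInsert ℓ hℓ j s).perm σ := by
  refine (eq_WInsert ℓ hℓ j _ (fun i => ?_) fun i l => ?_).symm
  · have e : (s.perm σ).map (WBase g q) = (s.map (WBase g q)).perm σ := rfl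
    rw [e, hℓ']
    exact WInsert_apply_same ℓ hℓ j s (σ i)
  · exact WInsert_apply_succAbove ℓ hℓ j s (σ i) l

end FibredProducts

/-! ### Alternating chains of the fibred products -/

section IsAlternating

variable {E : Type u} {F : Type v} [NormedAddCommGroup E] [NormedSpace ℝ E]
  {X : Geometry.SimplicialComplex ℝ E} {f : E → F} {n k : ℕ} (κ : ChainConvention)

/-- The chains `c` of `W^k(f)` with `σ_# c = sign σ c` for all permutations `σ`. -/
def IsAlternating (c : Chain κ (W X f k) n) : Prop :=
  ∀ σ : Equiv.Perm (Fin k), chainMap κ (WPerm X f k σ) n c = (Equiv.Perm.sign σ : ℤ) • c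

theorem isAlternating_of_one (c : Chain κ (W X f 1) n) : IsAlternating κ c := by
  intro σ
  obtain rfl : σ = 1 := Subsingleton.elim _ _
  have h : chainMap κ (WPerm X f 1 1) n = LinearMap.id :=
    chain_hom_ext κ fun s => by
      rw [chainMap_basisChain, LinearMap.id_apply]
      exact congrArg _ (WSimplex_ext fun _ _ => rfl)
  rw [h, Equiv.Perm.sign_one, Units.val_one, one_smul, LinearMap.id_apply]

theorem IsAlternating.smul {κ : ChainConvention} {c : Chain κ (W X f k) n}
    (hc : IsAlternating κ c) (m : ℤ) : IsAlternating κ (m • c) := fun σ => by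
  rw [map_smul, hc σ, smul_comm]

end IsAlternating

/-! ### Contractions on chains of the fibred products -/

section FibredProductChains

variable {E : Type u} {F : Type v} [NormedAddCommGroup E] [NormedSpace ℝ E]
  [NormedAddCommGroup F] [NormedSpace ℝ F]
  {X : Geometry.SimplicialComplex ℝ E} {Y : Geometry.SimplicialComplex ℝ F}
  {g : NondegMap X.toPreAbstractSimplicialComplex Y.toPreAbstractSimplicialComplex} {n : ℕ}

/-- The operator on chains which inserts the lift `ℓ` as a new `j`-th component. -/
noncomputable def insertChain (κ : ChainConvention)
    (ℓ : OrderedSimplex Y.toPreAbstractSimplicialComplex n → XSimplex X n)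
    (hℓ : ∀ y i, g.toFun ((ℓ y).1 i) = y.1 i) (hℓ' : ∀ y σ, ℓ (y.perm σ) = (ℓ y).perm σ)
    (q : ℕ) (j : Fin (q + 2)) :
    Chain κ (W X g.toFun (q + 1)) n →ₗ[ℤ] Chain κ (W X g.toFun (q + 2)) n :=
  permMap κ (WInsert ℓ hℓ j) (WInsert_perm ℓ hℓ hℓ' j)

/-- The section `C_n(Y) → C_n(W^1(f))` of `f_#` given by the lift `ℓ`. -/
noncomputable def liftChain (κ : ChainConvention)
    (ℓ : OrderedSimplex Y.toPreAbstractSimplicialComplex n → XSimplex X n)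
    (hℓ : ∀ y i, g.toFun ((ℓ y).1 i) = y.1 i) (hℓ' : ∀ y σ, ℓ (y.perm σ) = (ℓ y).perm σ) :
    Chain κ Y.toPreAbstractSimplicialComplex n →ₗ[ℤ] Chain κ (W X g.toFun 1) n :=
  permMap κ (WLift ℓ hℓ) fun y σ => WSimplex_ext fun i _ =>
    congrArg (fun s : XSimplex X n => s.1 i) (hℓ' y σ)

variable (κ : ChainConvention)
  (ℓ : OrderedSimplex Y.toPreAbstractSimplicialComplex n → XSimplex X n)
  (hℓ : ∀ y i, g.toFun ((ℓ y).1 i) = y.1 i) (hℓ' : ∀ y σ, ℓ (y.perm σ) = (ℓ y).perm σ)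

theorem chainMap_WBase_liftChain (c : Chain κ Y.toPreAbstractSimplicialComplex n) :
    chainMap κ (WBase g 0) n (liftChain κ ℓ hℓ hℓ' c) = c := by
  have h : (chainMap κ (WBase g 0) n).comp (liftChain κ ℓ hℓ hℓ') = LinearMap.id := by
    refine chain_hom_ext κ fun s => ?_
    rw [LinearMap.comp_apply, liftChain, permMap_basisChain, chainMap_basisChain,
      LinearMap.id_apply]
    exact congrArg _ (OrderedSimplex.ext' fun i => hℓ s i)
  exact LinearMap.congr_fun h c

theorem chainMap_WProj_insertChain (q : ℕ) (j : Fin (q + 2))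
    (c : Chain κ (W X g.toFun (q + 1)) n) :
    chainMap κ (WProj X g.toFun q j) n (insertChain κ ℓ hℓ hℓ' q j c) = c := by
  have h : (chainMap κ (WProj X g.toFun q j) n).comp (insertChain κ ℓ hℓ hℓ' q j)
      = LinearMap.id := by
    refine chain_hom_ext κ fun s => ?_
    rw [LinearMap.comp_apply, insertChain, permMap_basisChain, chainMap_basisChain,
      LinearMap.id_apply, WInsert_map_WProj]
  exact LinearMap.congr_fun h c

theorem chainMap_WProj_succ_insertChain_zero (q : ℕ) (i : Fin (q + 2))
    (c : Chain κ (W X g.toFun (q + 2)) n) :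
    chainMap κ (WProj X g.toFun (q + 1) i.succ) n (insertChain κ ℓ hℓ hℓ' (q + 1) 0 c)
      = insertChain κ ℓ hℓ hℓ' q 0 (chainMap κ (WProj X g.toFun q i) n c) := by
  have h : (chainMap κ (WProj X g.toFun (q + 1) i.succ) n).comp
      (insertChain κ ℓ hℓ hℓ' (q + 1) 0)
      = (insertChain κ ℓ hℓ hℓ' q 0).comp (chainMap κ (WProj X g.toFun q i) n) := by
    refine chain_hom_ext κ fun s => ?_
    rw [LinearMap.comp_apply, LinearMap.comp_apply, insertChain, insertChain, permMap_basisChain,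
      chainMap_basisChain, chainMap_basisChain, permMap_basisChain, WInsert_zero_map_WProj_succ]
  exact LinearMap.congr_fun h c

theorem chainMap_WProj_last_insertChain_castSucc (q : ℕ) (j : Fin (q + 2))
    (c : Chain κ (W X g.toFun (q + 2)) n) :
    chainMap κ (WProj X g.toFun (q + 1) (Fin.last (q + 2))) n
        (insertChain κ ℓ hℓ hℓ' (q + 1) j.castSucc c)
      = insertChain κ ℓ hℓ hℓ' q j
        (chainMap κ (WProj X g.toFun q (Fin.last (q + 1))) n c) := by
  have h : (chainMap κ (WProj X g.toFun (q + 1) (Fin.last (q + 2))) n).comp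
      (insertChain κ ℓ hℓ hℓ' (q + 1) j.castSucc)
      = (insertChain κ ℓ hℓ hℓ' q j).comp
        (chainMap κ (WProj X g.toFun q (Fin.last (q + 1))) n) := by
    refine chain_hom_ext κ fun s => ?_
    rw [LinearMap.comp_apply, LinearMap.comp_apply, insertChain, insertChain, permMap_basisChain,
      chainMap_basisChain, chainMap_basisChain, permMap_basisChain,
      WInsert_castSucc_map_WProj_last]
  exact LinearMap.congr_fun h c

theorem chainMap_WProj_one_insertChain_zero (c : Chain κ (W X g.toFun 1) n) :
    chainMap κ (WProj X g.toFun 0 1) n (insertChain κ ℓ hℓ hℓ' 0 0 c)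
      = liftChain κ ℓ hℓ hℓ' (chainMap κ (WBase g 0) n c) := by
  have h : (chainMap κ (WProj X g.toFun 0 1) n).comp (insertChain κ ℓ hℓ hℓ' 0 0)
      = (liftChain κ ℓ hℓ hℓ').comp (chainMap κ (WBase g 0) n) := by
    refine chain_hom_ext κ fun s => ?_
    rw [LinearMap.comp_apply, LinearMap.comp_apply, insertChain, liftChain, permMap_basisChain,
      chainMap_basisChain, chainMap_basisChain, permMap_basisChain, WInsert_zero_map_WProj_one]
  exact LinearMap.congr_fun h c

/-- Insertion in the first place is a contracting homotopy for `ρ`. -/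
theorem rho_insertChain_zero (q : ℕ) (c : Chain κ (W X g.toFun (q + 2)) n) :
    rho κ X g.toFun n (q + 1) (insertChain κ ℓ hℓ hℓ' (q + 1) 0 c)
      = c - insertChain κ ℓ hℓ hℓ' q 0 (rho κ X g.toFun n q c) := by
  simp only [rho, LinearMap.sum_apply, LinearMap.smul_apply, map_sum, map_smul]
  rw [Fin.sum_univ_succ, chainMap_WProj_insertChain, sub_eq_add_neg, ← Finset.sum_neg_distrib]
  simp only [chainMap_WProj_succ_insertChain_zero, Fin.val_zero, pow_zero, one_smul, Fin.val_succ,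
    pow_succ, mul_neg, mul_one, neg_smul]

theorem rho_zero_insertChain_zero (c : Chain κ (W X g.toFun 1) n) :
    rho κ X g.toFun n 0 (insertChain κ ℓ hℓ hℓ' 0 0 c)
      = c - liftChain κ ℓ hℓ hℓ' (chainMap κ (WBase g 0) n c) := by
  simp only [rho, LinearMap.sum_apply, LinearMap.smul_apply]
  rw [Fin.sum_univ_two, chainMap_WProj_insertChain, chainMap_WProj_one_insertChain_zero]
  simp [sub_eq_add_neg]

theorem chainMap_WBase_WProj {q : ℕ} (i : Fin (q + 2)) (c : Chain κ (W X g.toFun (q + 2)) n) :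
    chainMap κ (WBase g q) n (chainMap κ (WProj X g.toFun q i) n c)
      = chainMap κ (WBase g (q + 1)) n c := by
  have h : (chainMap κ (WBase g q) n).comp (chainMap κ (WProj X g.toFun q i) n)
      = chainMap κ (WBase g (q + 1)) n := by
    refine chain_hom_ext κ fun s => ?_
    rw [LinearMap.comp_apply, chainMap_basisChain, chainMap_basisChain, chainMap_basisChain,
      map_WProj_WBase]
  exact LinearMap.congr_fun h c

theorem chainMap_WBase_rho (c : Chain κ (W X g.toFun 2) n) :
    chainMap κ (WBase g 0) n (rho κ X g.toFun n 0 c) = 0 := by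
  simp only [rho, LinearMap.sum_apply, LinearMap.smul_apply, map_sum, map_smul]
  rw [Fin.sum_univ_two, chainMap_WBase_WProj, chainMap_WBase_WProj]
  simp

/-- The alternating sum of all insertions of the lift `ℓ`, that is, the exterior product with `ℓ`. -/
noncomputable def altInsertChain (q : ℕ) :
    Chain κ (W X g.toFun (q + 1)) n →ₗ[ℤ] Chain κ (W X g.toFun (q + 2)) n :=
  ∑ j : Fin (q + 2), (-1 : ℤ) ^ (j : ℕ) • insertChain κ ℓ hℓ hℓ' q j

theorem chainMap_WPerm_insertChain {q : ℕ} (σ : Equiv.Perm (Fin (q + 2)))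
    (τ : Equiv.Perm (Fin (q + 1))) (i : Fin (q + 2))
    (h : ∀ l, σ (i.succAbove l) = (σ i).succAbove (τ l)) (c : Chain κ (W X g.toFun (q + 1)) n) :
    chainMap κ (WPerm X g.toFun (q + 2) σ) n (insertChain κ ℓ hℓ hℓ' q (σ i) c)
      = insertChain κ ℓ hℓ hℓ' q i (chainMap κ (WPerm X g.toFun (q + 1) τ) n c) := by
  have h : (chainMap κ (WPerm X g.toFun (q + 2) σ) n).comp (insertChain κ ℓ hℓ hℓ' q (σ i))
      = (insertChain κ ℓ hℓ hℓ' q i).comp (chainMap κ (WPerm X g.toFun (q + 1) τ) n) := by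
    refine chain_hom_ext κ fun s => ?_
    rw [LinearMap.comp_apply, LinearMap.comp_apply, insertChain, insertChain, permMap_basisChain,
      chainMap_basisChain, chainMap_basisChain, permMap_basisChain,
      WInsert_map_WPerm ℓ hℓ σ τ i h]
  exact LinearMap.congr_fun h c

theorem IsAlternating.altInsertChain {q : ℕ} {c : Chain κ (W X g.toFun (q + 1)) n}
    (hc : IsAlternating κ c) : IsAlternating κ (altInsertChain κ ℓ hℓ hℓ' q c) := by
  intro σ
  simp only [ICSS.altInsertChain, LinearMap.sum_apply, LinearMap.smul_apply, map_sum, map_smul,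
    Finset.smul_sum]
  rw [← Equiv.sum_comp σ]
  refine Finset.sum_congr rfl fun i _ => ?_
  obtain ⟨τ, h1, h2⟩ := exists_perm_succAbove σ i
  rw [chainMap_WPerm_insertChain κ ℓ hℓ hℓ' σ τ i h1, hc τ, map_smul, smul_smul, h2, smul_smul]

/-- Up to sign, the exterior product with `ℓ` is a contracting homotopy for the projection which
forgets the last component. -/
theorem chainMap_WProj_last_altInsertChain (q : ℕ) (c : Chain κ (W X g.toFun (q + 2)) n) :
    chainMap κ (WProj X g.toFun (q + 1) (Fin.last (q + 2))) n
        (altInsertChain κ ℓ hℓ hℓ' (q + 1) c)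
      = altInsertChain κ ℓ hℓ hℓ' q (chainMap κ (WProj X g.toFun q (Fin.last (q + 1))) n c)
        + (-1 : ℤ) ^ (q + 2) • c := by
  simp only [altInsertChain, LinearMap.sum_apply, LinearMap.smul_apply, map_sum, map_smul]
  rw [Fin.sum_univ_castSucc, chainMap_WProj_insertChain]
  simp only [chainMap_WProj_last_insertChain_castSucc, Fin.val_castSucc, Fin.val_last]

theorem chainMap_WProj_last_altInsertChain_zero (c : Chain κ (W X g.toFun 1) n) :
    chainMap κ (WProj X g.toFun 0 (Fin.last 1)) n (altInsertChain κ ℓ hℓ hℓ' 0 c)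
      = liftChain κ ℓ hℓ hℓ' (chainMap κ (WBase g 0) n c) + (-1 : ℤ) ^ 1 • c := by
  simp only [altInsertChain, LinearMap.sum_apply, LinearMap.smul_apply, map_sum, map_smul]
  rw [Fin.sum_univ_castSucc, chainMap_WProj_insertChain, Fin.sum_univ_one]
  refine congrArg (· + (-1 : ℤ) ^ 1 • c) ?_
  rw [← chainMap_WProj_one_insertChain_zero]
  exact one_smul ℤ _

end FibredProductChains

/-! ### The double complex of the fibred products -/

section WRows

variable {E : Type u} {F : Type v} [NormedAddCommGroup E] [NormedSpace ℝ E]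
  [NormedAddCommGroup F] [NormedSpace ℝ F]
  {X : Geometry.SimplicialComplex ℝ E} {Y : Geometry.SimplicialComplex ℝ F}
  {g : NondegMap X.toPreAbstractSimplicialComplex Y.toPreAbstractSimplicialComplex}

theorem smul_neg_one_pow_eq_zero {M : Type*} [AddCommGroup M] {p : ℕ} {x : M}
    (h : (-1 : ℤ) ^ p • x = 0) : x = 0 := by
  rcases neg_one_pow_eq_or ℤ p with e | e <;> simpa [e] using h

theorem neg_one_pow_smul_smul {M : Type*} [AddCommGroup M] (p : ℕ) (x : M) :
    (-1 : ℤ) ^ p • (-1 : ℤ) ^ p • x = x := by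
  rw [smul_smul, ← pow_add, Even.neg_one_pow ⟨p, rfl⟩, one_smul]

theorem rowsExact_WDoubleComplex (κ : ChainConvention)
    (hg : ∀ t ∈ Y.faces, ∃ s ∈ X.faces, g.toFun '' s = t) :
    (WDoubleComplex κ X g.toFun).RowsExact := by
  intro p q (x : Chain κ (W X g.toFun (q + 2)) p) hx
  obtain ⟨ℓ, hℓ, hℓ'⟩ := exists_perm_lift g hg p
  replace hx : rho κ X g.toFun p q x = 0 := smul_neg_one_pow_eq_zero hx
  refine ⟨(-1 : ℤ) ^ p • insertChain κ ℓ hℓ hℓ' (q + 1) 0 x, ?_⟩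
  change (-1 : ℤ) ^ p • rho κ X g.toFun p (q + 1) ((-1 : ℤ) ^ p • _) = x
  rw [map_smul, neg_one_pow_smul_smul, rho_insertChain_zero, hx, map_zero, sub_zero]

theorem nonempty_totHomology_WDoubleComplex_equiv (κ : ChainConvention)
    (hg : ∀ t ∈ Y.faces, ∃ s ∈ X.faces, g.toFun '' s = t) (n : ℕ) :
    Nonempty ((WDoubleComplex κ X g.toFun).totHomology n ≃ₗ[ℤ]
      simplicialHomology κ Y.toPreAbstractSimplicialComplex n) := by
  refine (rowsExact_WDoubleComplex κ hg).nonempty_totHomology_equiv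
    (boundary κ Y.toPreAbstractSimplicialComplex) (cycles κ Y.toPreAbstractSimplicialComplex)
    rfl (fun _ => rfl) (fun p => chainMap κ (WBase g 0) p) (fun p y => ?_)
    (fun p x => (boundary_chainMap κ (WBase g 0) p x).symm)
    (fun p (x : Chain κ (W X g.toFun 2) p) => ?_)
    (fun p (x : Chain κ (W X g.toFun 1) p) (hx : chainMap κ (WBase g 0) p x = 0) => ?_) n
  · obtain ⟨ℓ, hℓ, hℓ'⟩ := exists_perm_lift g hg p
    exact ⟨_, chainMap_WBase_liftChain κ ℓ hℓ hℓ' y⟩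
  · change chainMap κ (WBase g 0) p ((-1 : ℤ) ^ p • rho κ X g.toFun p 0 x) = 0
    rw [map_smul, chainMap_WBase_rho, smul_zero]
  · obtain ⟨ℓ, hℓ, hℓ'⟩ := exists_perm_lift g hg p
    refine ⟨(-1 : ℤ) ^ p • insertChain κ ℓ hℓ hℓ' 0 0 x, ?_⟩
    change (-1 : ℤ) ^ p • rho κ X g.toFun p 0 ((-1 : ℤ) ^ p • _) = x
    rw [map_smul, neg_one_pow_smul_smul, rho_zero_insertChain_zero, hx, map_zero, sub_zero]

end WRows

/-! ### Simplices of the multiple point spaces -/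

section StrictPoints

variable {E : Type u} {F : Type v} [NormedAddCommGroup E] [NormedSpace ℝ E]
  [NormedAddCommGroup F] [NormedSpace ℝ F]
  {X : Geometry.SimplicialComplex ℝ E} {Y : Geometry.SimplicialComplex ℝ F}
  {g : NondegMap X.toPreAbstractSimplicialComplex Y.toPreAbstractSimplicialComplex} {n : ℕ}

/-- Weights on the vertices of an ordered simplex, indexed by their positions, are extended to a
function on the ambient space. -/
theorem sum_map_extend {V M : Type*} [AddCommMonoid M] (a : Fin (n + 1) ↪ V)
    (ω : Fin (n + 1) → ℝ) (h : ℝ → V → M) :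
    ∑ x ∈ Finset.univ.map a, h (Function.extend a ω 0 x) x = ∑ i, h (ω i) (a i) := by
  rw [Finset.sum_map]
  simp only [a.injective.extend_apply]

theorem forall_extend_of_forall {V : Type*} {a : Fin (n + 1) ↪ V} {ω : Fin (n + 1) → ℝ}
    {P : ℝ → Prop} (hω : ∀ i, P (ω i)) : ∀ x ∈ Finset.univ.map a, P (Function.extend a ω 0 x) := by
  intro x hx
  obtain ⟨i, -, rfl⟩ := Finset.mem_map.1 hx
  rw [a.injective.extend_apply]
  exact hω i

theorem sum_smul_mem_convexHull (a : XSimplex X n) {ω : Fin (n + 1) → ℝ} (hω : ∀ i, 0 ≤ ω i)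
    (hω1 : ∑ i, ω i = 1) :
    ∑ i, ω i • a.1 i ∈ convexHull ℝ ((Finset.univ.map a.1 : Finset E) : Set E) := by
  refine Finset.mem_convexHull'.2
    ⟨Function.extend a.1 ω 0, forall_extend_of_forall (P := (0 ≤ ·)) hω, ?_, ?_⟩
  · rw [sum_map_extend a.1 ω fun r _ => r, hω1]
  · rw [sum_map_extend a.1 ω fun r x => r • x]

/-- Two simplices of `X` over the same simplex of `Y` are equal if their points with the same
positive barycentric coordinates agree. -/
theorem eq_of_sum_smul_eq {a b : XSimplex X n}
    (hab : ∀ i, g.toFun (a.1 i) = g.toFun (b.1 i)) {ω : Fin (n + 1) → ℝ} (hω : ∀ i, 0 < ω i)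
    (hω1 : ∑ i, ω i = 1) (h : ∑ i, ω i • a.1 i = ∑ i, ω i • b.1 i) : a = b := by
  have hsub : Finset.univ.map a.1 ⊆ Finset.univ.map b.1 := by
    refine subset_of_sum_mem_convexHull a.2 b.2 (w := Function.extend a.1 ω 0)
      (forall_extend_of_forall (P := (0 < ·)) hω) ?_ ?_
    · rw [sum_map_extend a.1 ω fun r _ => r, hω1]
    · rw [sum_map_extend a.1 ω fun r x => r • x, h]
      exact sum_smul_mem_convexHull b (fun i => (hω i).le) hω1
  exact OrderedSimplex.ext' fun i =>
    g.injOn _ b.2 (hsub (by simp)) (by simp) (hab i)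

/-- A simplex of `W^k(f)` with pairwise distinct components has its interior in `D_S^k(f)`. -/
theorem sum_smul_mem_strictMultiplePoints (hg : IsSimplicialMap X Y g.toFun) {k : ℕ}
    (s : OrderedSimplex (W X g.toFun k) n) (hs : Function.Injective (WComponent s))
    {ω : Fin (n + 1) → ℝ} (hω : ∀ i, 0 < ω i) (hω1 : ∑ i, ω i = 1) :
    ∑ i, ω i • s.1 i ∈ strictMultiplePoints X g.toFun k := by
  have hc : ∀ l, (∑ i, ω i • s.1 i) l = ∑ i, ω i • (WComponent s l).1 i := fun l => by
    rw [Finset.sum_apply]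
    rfl
  have hfc : ∀ l, g.toFun ((∑ i, ω i • s.1 i) l) = ∑ i, ω i • g.toFun (s.1 i l) := fun l => by
    have h := hg.affine _ (WComponent s l).2 (Function.extend (WComponent s l).1 ω 0)
      (forall_extend_of_forall (P := (0 ≤ ·)) fun i => (hω i).le)
      (by rw [sum_map_extend _ ω fun r _ => r, hω1])
    rw [sum_map_extend _ ω fun r x => r • x, sum_map_extend _ ω fun r x => r • g.toFun x] at h
    rw [hc]
    exact h
  refine ⟨fun l => ?_, fun l m hlm h => hlm (hs ?_), fun l m => ?_⟩
  · rw [hc]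
    exact X.convexHull_subset_space (WComponent s l).2
      (sum_smul_mem_convexHull _ (fun i => (hω i).le) hω1)
  · rw [hc, hc] at h
    exact eq_of_sum_smul_eq (fun i => W_apply_eq s i l m) hω hω1 h
  · rw [hfc, hfc]
    simp only [W_apply_eq s _ l m]

/-- A simplex of `W^k(f)` with pairwise distinct components is a simplex of `D^k(f)`: push its
points towards the barycentre. -/
theorem mem_D_of_injective_WComponent (hg : IsSimplicialMap X Y g.toFun) {k : ℕ}
    (s : OrderedSimplex (W X g.toFun k) n) (hs : Function.Injective (WComponent s)) :
    Finset.univ.map s.1 ∈ (D X g.toFun k).faces := by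
  refine ⟨s.2, fun x hx => ?_⟩
  obtain ⟨w, hw, hw1, rfl⟩ := Finset.mem_convexHull'.1 hx
  rw [Finset.sum_map] at hw1 ⊢
  have hw0 : ∀ i, 0 ≤ w (s.1 i) := fun i => hw _ (by simp)
  have hn : (0 : ℝ) < (n : ℝ) + 1 := by positivity
  -- For `0 < ε < 1` the barycentric coordinates of `γ ε` are positive.
  let γ : ℝ → Fin k → E := fun ε => ∑ i, ((1 - ε) * w (s.1 i) + ε * ((n : ℝ) + 1)⁻¹) • s.1 i
  have hγ : Continuous γ := by fun_prop
  have hγ0 : γ 0 = ∑ i, w (s.1 i) • s.1 i := by simp [γ]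
  refine ⟨?_, fun l => ?_⟩
  · rw [← hγ0]
    refine map_mem_closure hγ (s := Set.Ioo 0 1) (by simp) ?_
    intro ε hε
    refine sum_smul_mem_strictMultiplePoints hg s hs (fun i => ?_) ?_
    · have h1 := mul_nonneg (sub_nonneg.2 hε.2.le) (hw0 i)
      have h2 := mul_pos hε.1 (inv_pos.2 hn)
      linarith
    · rw [Finset.sum_add_distrib, ← Finset.mul_sum, hw1]
      simp only [Finset.sum_const, Finset.card_univ, Fintype.card_fin, nsmul_eq_mul]
      push_cast
      field_simp
      ring
  · rw [Finset.sum_apply]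
    exact X.convexHull_subset_space (WComponent s l).2 (sum_smul_mem_convexHull _ hw0 hw1)

end StrictPoints

/-! ### Alternating chains of the multiple point spaces -/

section DChains

variable {E : Type u} {F : Type v} [NormedAddCommGroup E] [NormedSpace ℝ E]
  {X : Geometry.SimplicialComplex ℝ E} {f : E → F} {n k : ℕ}

/-- The inclusion of `D^k(f)` in `W^k(f)`. -/
def DIncl (X : Geometry.SimplicialComplex ℝ E) (f : E → F) (k : ℕ) :
    NondegMap (D X f k) (W X f k) where
  toFun := id
  injOn := fun _ _ => Function.injective_id.injOn
  image_mem := fun t ht => ⟨t, ht.1, (Set.image_id _).symm⟩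

theorem map_DIncl_injective :
    Function.Injective (OrderedSimplex.map (n := n) (DIncl X f k)) := fun _ _ h =>
  OrderedSimplex.ext' fun i => congrArg (fun s : OrderedSimplex (W X f k) n => s.1 i) h

theorem AltChain.isAlternating {κ : ChainConvention} (c : AltChain κ X f n k) :
    IsAlternating κ (chainMap κ (DIncl X f k) n c.1) := fun σ => by
  rw [← map_smul, ← c.2 σ]
  exact chainMap_chainMap_eq κ (DIncl X f k) _ (DPerm X f k σ) _ (fun _ => rfl) n c.1

theorem chainMap_DIncl_altProj {κ : ChainConvention} {q : ℕ}
    (c : AltChain κ X f n (q + 2)) :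
    chainMap κ (DIncl X f (q + 1)) n (altProj κ X f n q c).1
      = chainMap κ (WProj X f q (Fin.last (q + 1))) n (chainMap κ (DIncl X f (q + 2)) n c.1) := by
  refine chainMap_chainMap_eq κ (DProj X f q) _ _ _ (fun v => ?_) n c.1
  funext l
  exact congrArg v (Fin.succAbove_last_apply l).symm

end DChains

/-! ### The double complex of alternating chains -/

section AlternatingChains

variable {E : Type u} {F : Type v} [NormedAddCommGroup E] [NormedSpace ℝ E]
  [NormedAddCommGroup F] [NormedSpace ℝ F]
  {X : Geometry.SimplicialComplex ℝ E} {Y : Geometry.SimplicialComplex ℝ F}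
  {g : NondegMap X.toPreAbstractSimplicialComplex Y.toPreAbstractSimplicialComplex} {n : ℕ}

/-- The projection of `D^k(f)` to the target of `f`. -/
def DBase (g : NondegMap X.toPreAbstractSimplicialComplex Y.toPreAbstractSimplicialComplex)
    (q : ℕ) : NondegMap (D X g.toFun (q + 1)) Y.toPreAbstractSimplicialComplex where
  toFun := (WBase g q).toFun
  injOn := fun t ht => (WBase g q).injOn t ht.1
  image_mem := fun t ht => (WBase g q).image_mem t ht.1

/-- Free chains of `D^k(f)` embed in those of `W^k(f)`; the natural sections carry this over to
oriented chains. -/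
theorem chainMap_DIncl_injective (κ : ChainConvention) (g : NondegMap
    X.toPreAbstractSimplicialComplex Y.toPreAbstractSimplicialComplex) (n q : ℕ) :
    Function.Injective (chainMap κ (DIncl X g.toFun (q + 1)) n) := by
  obtain ⟨φ, h1, h2⟩ := exists_free_section.{u} κ Y.toPreAbstractSimplicialComplex n
  refine (injective_iff_map_eq_zero _).2 fun c hc => ?_
  have h := h2 (DBase g q) (WBase g q) (DIncl X g.toFun (q + 1)) (fun _ => rfl) c
  rw [hc, map_zero] at h
  have h0 : φ (DBase g q) c = 0 :=
    Finsupp.mapDomain_injective map_DIncl_injective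
      (h.trans (map_zero (freeMap (DIncl X g.toFun (q + 1)) n)).symm)
  rw [← h1 (DBase g q) c, h0, map_zero]

/-- Alternating chains of `W^k(f)` are chains of `D^k(f)`: a simplex with two equal components is
fixed by a transposition, so it has coefficient zero. -/
theorem IsAlternating.exists_chainMap_DIncl_eq {κ : ChainConvention}
    (hg : IsSimplicialMap X Y g.toFun) {q : ℕ} {c : Chain κ (W X g.toFun (q + 1)) n}
    (hc : IsAlternating κ c) : ∃ c', chainMap κ (DIncl X g.toFun (q + 1)) n c' = c := by
  obtain ⟨φ, h1, h2⟩ := exists_free_section.{u} κ Y.toPreAbstractSimplicialComplex n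
  set b := φ (WBase g q) c with hb
  have halt : ∀ σ, freeMap (WPerm X g.toFun (q + 1) σ) n b = (Equiv.Perm.sign σ : ℤ) • b :=
    fun σ => by
      rw [hb, h2 (WBase g q) (WBase g q) _ (map_WPerm_WBase σ), hc σ, map_smul]
  have hsupp : (b.support : Set (OrderedSimplex (W X g.toFun (q + 1)) n))
      ⊆ Set.range (OrderedSimplex.map (DIncl X g.toFun (q + 1))) := by
    intro s hs
    by_cases hi : Function.Injective (WComponent s)
    · exact ⟨⟨s.1, mem_D_of_injective_WComponent hg s hi⟩, rfl⟩
    exfalso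
    obtain ⟨l, m, hlm, hne⟩ := Function.not_injective_iff.1 hi
    let σ : Equiv.Perm (Fin (q + 1)) := Equiv.swap l m
    have hfix : s.map (WPerm X g.toFun (q + 1) σ) = s := by
      have hlm' : ∀ i, s.1 i l = s.1 i m := fun i => congrArg (fun a : XSimplex X n => a.1 i) hlm
      refine WSimplex_ext fun i j => ?_
      change s.1 i (Equiv.swap l m j) = s.1 i j
      rw [Equiv.swap_apply_def]
      split_ifs with h3 h4
      · rw [h3, hlm']
      · rw [h4, hlm']
      · rfl
    have hinj : Function.Injective
        (OrderedSimplex.map (n := n) (WPerm X g.toFun (q + 1) σ)) := fun a a' h =>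
      WSimplex_ext fun i j => by
        have := congrArg (fun t : OrderedSimplex (W X g.toFun (q + 1)) n => t.1 i (σ.symm j)) h
        change a.1 i (σ (σ.symm j)) = a'.1 i (σ (σ.symm j)) at this
        rwa [Equiv.apply_symm_apply] at this
    have h3 := DFunLike.congr_fun (halt σ) (s.map (WPerm X g.toFun (q + 1) σ))
    rw [freeMap, Finsupp.lmapDomain_apply, Finsupp.mapDomain_apply hinj, hfix,
      Equiv.Perm.sign_swap hne] at h3
    have h4 : b s = -b s := by simpa using h3
    exact Finsupp.mem_support_iff.1 hs (by lia)
  refine ⟨(chainRel κ _ n).mkQ (b.comapDomain _ map_DIncl_injective.injOn), ?_⟩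
  have h5 := Finsupp.mapDomain_comapDomain _ map_DIncl_injective b hsupp
  rw [← h1 (WBase g q) c, ← hb]
  conv_rhs => rw [← h5]
  rfl

theorem IsAlternating.exists_altChain {κ : ChainConvention}
    (hg : IsSimplicialMap X Y g.toFun) {q : ℕ} {c : Chain κ (W X g.toFun (q + 1)) n}
    (hc : IsAlternating κ c) :
    ∃ c' : AltChain κ X g.toFun n (q + 1), chainMap κ (DIncl X g.toFun (q + 1)) n c'.1 = c := by
  obtain ⟨c', rfl⟩ := hc.exists_chainMap_DIncl_eq hg
  refine ⟨⟨c', fun σ => chainMap_DIncl_injective κ g n q ?_⟩, rfl⟩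
  rw [map_smul, ← hc σ]
  exact chainMap_chainMap_eq κ (DPerm X g.toFun (q + 1) σ) _ (DIncl X g.toFun (q + 1)) _
    (fun _ => rfl) n c'

/-- Every alternating chain of `D^k(f)`, `k > 1`, whose projection vanishes, is a projection. -/
theorem exists_altProj_eq {κ : ChainConvention} (hg : IsSimplicialMap X Y g.toFun)
    (hg' : ∀ t ∈ Y.faces, ∃ s ∈ X.faces, g.toFun '' s = t) {q : ℕ}
    (c : AltChain κ X g.toFun n (q + 2)) (hc : altProj κ X g.toFun n q c = 0) :
    ∃ c', altProj κ X g.toFun n (q + 1) c' = c := by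
  obtain ⟨ℓ, hℓ, hℓ'⟩ := exists_perm_lift g hg' n
  obtain ⟨c', h⟩ := (((AltChain.isAlternating c).altInsertChain κ ℓ hℓ hℓ').smul
    ((-1 : ℤ) ^ (q + 2))).exists_altChain hg
  refine ⟨c', Subtype.ext (chainMap_DIncl_injective κ g n _ ?_)⟩
  have h0 := chainMap_DIncl_altProj c
  rw [hc] at h0
  rw [chainMap_DIncl_altProj, h, map_smul, chainMap_WProj_last_altInsertChain, ← h0, smul_add,
    neg_one_pow_smul_smul]
  simp

/-- The augmentation of the alternating chains. -/
noncomputable def altAugmentation (κ : ChainConvention)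
    (g : NondegMap X.toPreAbstractSimplicialComplex Y.toPreAbstractSimplicialComplex) (n : ℕ) :
    AltChain κ X g.toFun n 1 →ₗ[ℤ] Chain κ Y.toPreAbstractSimplicialComplex n :=
  (chainMap κ (DBase g 0) n).comp (Submodule.subtype _)

theorem altAugmentation_eq {κ : ChainConvention} (c : AltChain κ X g.toFun n 1) :
    altAugmentation κ g n c
      = chainMap κ (WBase g 0) n (chainMap κ (DIncl X g.toFun 1) n c.1) := by
  have h : chainMap κ (DBase g 0) n
      = (chainMap κ (WBase g 0) n).comp (chainMap κ (DIncl X g.toFun 1) n) :=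
    chain_hom_ext κ fun s => by
      rw [LinearMap.comp_apply, chainMap_basisChain, chainMap_basisChain, chainMap_basisChain]
      rfl
  exact LinearMap.congr_fun h c.1

theorem altAugmentation_surjective {κ : ChainConvention} (hg : IsSimplicialMap X Y g.toFun)
    (hg' : ∀ t ∈ Y.faces, ∃ s ∈ X.faces, g.toFun '' s = t) :
    Function.Surjective (altAugmentation κ g n) := by
  intro y
  obtain ⟨ℓ, hℓ, hℓ'⟩ := exists_perm_lift g hg' n
  obtain ⟨c, hc⟩ := (isAlternating_of_one κ (liftChain κ ℓ hℓ hℓ' y)).exists_altChain hg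
  exact ⟨c, by rw [altAugmentation_eq, hc, chainMap_WBase_liftChain]⟩

theorem altAugmentation_altProj {κ : ChainConvention} (c : AltChain κ X g.toFun n 2) :
    altAugmentation κ g n (altProj κ X g.toFun n 0 c) = 0 := by
  -- The two projections to `X` agree over `Y`, and the transposition exchanges them with a sign.
  have h1 := congrArg (chainMap κ (WBase g 1) n)
    ((AltChain.isAlternating c) (Equiv.swap 0 1))
  have h2 : (chainMap κ (WBase g 1) n).comp (chainMap κ (WPerm X g.toFun 2 (Equiv.swap 0 1)) n)
      = chainMap κ (WBase g 1) n :=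
    chain_hom_ext κ fun s => by
      rw [LinearMap.comp_apply, chainMap_basisChain, chainMap_basisChain, chainMap_basisChain]
      exact congrArg _ (map_WPerm_WBase (q := 1) _ s)
  have h3 := LinearMap.congr_fun h2 (chainMap κ (DIncl X g.toFun 2) n c.1)
  rw [LinearMap.comp_apply] at h3
  rw [h3, Equiv.Perm.sign_swap (by decide), map_smul] at h1
  rw [altAugmentation_eq]
  refine (congrArg (chainMap κ (WBase g 0) n) (chainMap_DIncl_altProj c)).trans ?_
  rw [chainMap_WBase_WProj]
  apply chain_eq_zero_of_two_smul
  nth_rw 1 [h1]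
  simp

/-- Every alternating chain of `D^1(f)` whose augmentation vanishes is a projection. -/
theorem exists_altProj_eq_of_altAugmentation_eq_zero {κ : ChainConvention}
    (hg : IsSimplicialMap X Y g.toFun)
    (hg' : ∀ t ∈ Y.faces, ∃ s ∈ X.faces, g.toFun '' s = t)
    (c : AltChain κ X g.toFun n 1) (hc : altAugmentation κ g n c = 0) :
    ∃ c', altProj κ X g.toFun n 0 c' = c := by
  obtain ⟨ℓ, hℓ, hℓ'⟩ := exists_perm_lift g hg' n
  obtain ⟨c', h⟩ := (((AltChain.isAlternating c).altInsertChain κ ℓ hℓ hℓ').smul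
    ((-1 : ℤ) ^ 1)).exists_altChain hg
  refine ⟨c', Subtype.ext (chainMap_DIncl_injective κ g n 0 ?_)⟩
  rw [altAugmentation_eq] at hc
  refine (chainMap_DIncl_altProj c').trans ?_
  rw [h, map_smul]
  refine (congrArg ((-1 : ℤ) ^ 1 • ·)
    (chainMap_WProj_last_altInsertChain_zero κ ℓ hℓ hℓ' _)).trans ?_
  simp only [hc, map_zero, zero_add]
  exact neg_one_pow_smul_smul 1 _

theorem rowsExact_DDoubleComplex (κ : ChainConvention) (hg : IsSimplicialMap X Y g.toFun)
    (hg' : ∀ t ∈ Y.faces, ∃ s ∈ X.faces, g.toFun '' s = t) :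
    (DDoubleComplex κ X g.toFun).RowsExact := by
  intro p q (x : AltChain κ X g.toFun p (q + 2)) hx
  obtain ⟨y, rfl⟩ := exists_altProj_eq hg hg' x (smul_neg_one_pow_eq_zero hx)
  refine ⟨(-1 : ℤ) ^ p • y, ?_⟩
  change (-1 : ℤ) ^ p • altProj κ X g.toFun p (q + 1) ((-1 : ℤ) ^ p • y) = _
  rw [map_smul, neg_one_pow_smul_smul]

theorem nonempty_totHomology_DDoubleComplex_equiv (κ : ChainConvention)
    (hg : IsSimplicialMap X Y g.toFun)
    (hg' : ∀ t ∈ Y.faces, ∃ s ∈ X.faces, g.toFun '' s = t) (n : ℕ) :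
    Nonempty ((DDoubleComplex κ X g.toFun).totHomology n ≃ₗ[ℤ]
      simplicialHomology κ Y.toPreAbstractSimplicialComplex n) := by
  refine (rowsExact_DDoubleComplex κ hg hg').nonempty_totHomology_equiv
    (boundary κ Y.toPreAbstractSimplicialComplex) (cycles κ Y.toPreAbstractSimplicialComplex)
    rfl (fun _ => rfl) (fun p => altAugmentation κ g p)
    (fun p => altAugmentation_surjective hg hg')
    (fun p (x : AltChain κ X g.toFun (p + 1) 1) => (boundary_chainMap κ (DBase g 0) p x.1).symm)
    (fun p (x : AltChain κ X g.toFun p 2) => ?_)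
    (fun p (x : AltChain κ X g.toFun p 1) (hx : altAugmentation κ g p x = 0) => ?_) n
  · change altAugmentation κ g p ((-1 : ℤ) ^ p • altProj κ X g.toFun p 0 x) = 0
    rw [map_smul, altAugmentation_altProj, smul_zero]
  · obtain ⟨y, rfl⟩ := exists_altProj_eq_of_altAugmentation_eq_zero hg hg' x hx
    refine ⟨(-1 : ℤ) ^ p • y, ?_⟩
    change (-1 : ℤ) ^ p • altProj κ X g.toFun p 0 ((-1 : ℤ) ^ p • y) = _
    rw [map_smul, neg_one_pow_smul_smul]

end AlternatingChains

end ICSS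

theorem proposition3p1 {E : Type*} {F : Type*} [NormedAddCommGroup E] [NormedSpace ℝ E]
    [NormedAddCommGroup F] [NormedSpace ℝ F]
    (X : Geometry.SimplicialComplex ℝ E) (Y : Geometry.SimplicialComplex ℝ F)
    (hX : ICSS.IsLocallyFinite X) (f : E → F) (hf : ICSS.IsSimplicialMap X Y f)
    (hsurj : Set.SurjOn f X.space Y.space)
    (hfin : ∀ y ∈ Y.space, (X.space ∩ f ⁻¹' {y}).Finite)
    (κ : ICSS.ChainConvention) :
    ((ICSS.WDoubleComplex κ X f).FirstSSCollapsesOntoPAxis ∧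
      ∀ n : ℕ,
        Nonempty ((ICSS.WDoubleComplex κ X f).firstSS 2 n 0 ≃ₗ[ℤ]
          (ICSS.WDoubleComplex κ X f).totHomology n) ∧
        Nonempty ((ICSS.WDoubleComplex κ X f).totHomology n ≃ₗ[ℤ]
          ICSS.simplicialHomology κ Y.toPreAbstractSimplicialComplex n)) ∧
    ((ICSS.DDoubleComplex κ X f).FirstSSCollapsesOntoPAxis ∧
      ∀ n : ℕ,
        Nonempty ((ICSS.DDoubleComplex κ X f).firstSS 2 n 0 ≃ₗ[ℤ]
          (ICSS.DDoubleComplex κ X f).totHomology n) ∧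
        Nonempty ((ICSS.DDoubleComplex κ X f).totHomology n ≃ₗ[ℤ]
          ICSS.simplicialHomology κ Y.toPreAbstractSimplicialComplex n)) := by
  have hg' : ∀ t ∈ Y.faces, ∃ s ∈ X.faces, f '' s = t := fun t ht => hf.exists_face hsurj ht
  have hW := ICSS.rowsExact_WDoubleComplex κ (g := hf.nondegMap hfin) hg'
  have hD := ICSS.rowsExact_DDoubleComplex κ (g := hf.nondegMap hfin) hf hg'
  exact ⟨⟨hW.firstSSCollapsesOntoPAxis, fun n => ⟨hW.nonempty_firstSS_equiv n,
      ICSS.nonempty_totHomology_WDoubleComplex_equiv κ (g := hf.nondegMap hfin) hg' n⟩⟩,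
    hD.firstSSCollapsesOntoPAxis, fun n => ⟨hD.nonempty_firstSS_equiv n,
      ICSS.nonempty_totHomology_DDoubleComplex_equiv κ (g := hf.nondegMap hfin) hf hg' n⟩⟩
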